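/- Let $\mathcal{C}$ be a model category. For $X\in\mathcal{C}$ let $\ell^\bullet X\in\mathcal{C}^{\Delta}$ be the value at $X$ of the left adjoint of evaluation in degree $0$ (so $(\ell^\bullet X)^n$ is the $(n+1)$-fold coproduct of $X$), let $r^\bullet X$ be the constant cosimplicial object, and let $\ell^\bullet X\to r^\bullet X$ be the fold map. A *cosimplicial frame* for $X$ is a cosimplicial object $X^\bullet$ with a factorisation $\ell^\bullet X\to X^\bullet\to r^\bullet X$ of this map into a Reedy cofibration followed by a levelwise weak equivalence. A *fibrant replacement* of $Y$ is a trivial cofibration $Y\to Y^{\mathrm{fib}}$ with $Y^{\mathrm{fib}}$ fibrant. Given such choices, the mapping space $\mathrm{map}_{\mathcal{C}}(X,Y)$ is the simplicial set $\mathcal{C}(X^\bullet,Y^{\mathrm{fib}})$ with $n$-simplices $\mathrm{Hom}_{\mathcal{C}}(X^n,Y^{\mathrm{fib}})$. Let $\mathrm{Ho}(\mathrm{sSet})$ be the localization of simplicial sets at the weak homotopy equivalences. Let $L:\mathcal{C}\rightleftarrows\mathcal{D}:R$ be an adjunction between model categories. (0) In $\mathcal{C}$ and in $\mathcal{D}$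 every object has a cosimplicial frame and a fibrant replacement, so that mapping spaces exist. (1) Suppose that $(L,R)$ is a Quillen adjunction, $X\in\mathcal{C}$ is cofibrant and $Y\in\mathcal{D}$. Then for every fibrant replacement $Y\to Y^{\mathrm{fib}}$, $$\mathrm{map}_{\mathcal{C}}(X,R(Y^{\mathrm{fib}}))\cong\mathrm{map}_{\mathcal{D}}(LX,Y)\quad\text{in }\mathrm{Ho}(\mathrm{sSet}),$$ and if $Y$ is fibrant, then $$\mathrm{map}_{\mathcal{C}}(X,RY)\cong\mathrm{map}_{\mathcal{D}}(LX,Y)\quad\text{in }\mathrm{Ho}(\mathrm{sSet}).$$ (2) Suppose that $(L,R)$ is a Quillen equivalence and $X,X'\in\mathcal{C}$ are cofibrant. Then $$\mathrm{map}_{\mathcal{C}}(X,X')\cong\mathrm{map}_{\mathcal{D}}(LX,LX')\quad\text{in }\mathrm{Ho}(\mathrm{sSet}).$$ In (1) and (2) the isomorphisms exist for all choices of the frames and fibrant replacements that enter the mapping spaces on the two sides. -/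

import Mathlib

open CategoryTheory Limits HomotopicalAlgebra Simplicial

universe v u u₁ u₂

noncomputable section

/-! ### The homotopy category of simplicial sets -/

namespace SSetHo

/-- The set `[K, Z]` of simplicial homotopy classes of maps `K ⟶ Z` (the quotient by the
equivalence relation generated by simplicial homotopy `K ⊗ Δ[1] ⟶ Z`). -/
def HomotopyClasses (K Z : SSet.{v}) : Type v :=
  Quot (fun f g : K ⟶ Z => Nonempty (SSet.Homotopy f g))

/-- The map `f^* : [K', Z] → [K, Z]` induced by `f : K ⟶ K'`. -/
def precompClasses {K K' : SSet.{v}} (f : K ⟶ K') (Z : SSet.{v}) :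
    HomotopyClasses K' Z → HomotopyClasses K Z :=
  Quot.map (fun g => f ≫ g) (by
    rintro g g' ⟨H⟩
    exact ⟨SSet.RelativeMorphism.Homotopy.precomp H
      (SSet.RelativeMorphism.botEquiv.symm f) (by cat_disch)⟩)

/-- The weak homotopy equivalences of simplicial sets: the maps `f : K ⟶ K'` such that
`f^* : [K', Z] → [K, Z]` is bijective for every Kan complex `Z`. These are the weak equivalences
of the Kan-Quillen model structure. -/
def weakHomotopyEquivalences : MorphismProperty SSet.{v} := fun _ _ f =>
  ∀ Z : SSet.{v}, SSet.KanComplex Z → Function.Bijective (precompClasses f Z)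

/-- The homotopy category `Ho(sSet)`: the localization of simplicial sets at the weak homotopy
equivalences. -/
abbrev Ho : Type _ := (weakHomotopyEquivalences.{v}).Localization

/-- Two simplicial sets are isomorphic in `Ho(sSet)`. -/
def IsoInHo (K K' : SSet.{v}) : Prop :=
  Nonempty ((weakHomotopyEquivalences.{v}).Q.obj K ≅ (weakHomotopyEquivalences.{v}).Q.obj K')

end SSetHo

/-! ### Reedy cofibrations of cosimplicial objects -/

namespace CosimplicialFrames

/-- The index category of the `n`-th latching object: injections `[k] ⟶ [n]` in the simplex
category that are not isomorphisms, with the morphisms over `[n]`. -/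
abbrev LatchingIndex (n : SimplexCategory) : Type :=
  ObjectProperty.FullSubcategory (fun f : Over n => Mono f.hom ∧ ¬ IsIso f.hom)

instance (n : SimplexCategory) : Finite (LatchingIndex n) := by
  let F : LatchingIndex n → Σ k : Fin (n.len + 1), (⦋(k : ℕ)⦌ ⟶ n) := fun f =>
    have hf : Mono f.obj.hom := f.property.1
    ⟨⟨f.obj.left.len, Nat.lt_succ_of_le (SimplexCategory.len_le_of_mono f.obj.hom)⟩, f.obj.hom⟩
  refine Finite.of_injective F ?_
  rintro ⟨⟨k, ⟨⟨⟩⟩, f⟩, hf⟩ ⟨⟨l, ⟨⟨⟩⟩, g⟩, hg⟩ h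
  have hlen : k.len = l.len := congrArg (fun x => (x.1 : ℕ)) h
  obtain rfl : k = l := by ext; exact hlen
  obtain rfl : f = g := by simpa [F] using h
  rfl

instance (n : SimplexCategory) (a b : LatchingIndex n) : Finite (a ⟶ b) :=
  Finite.of_injective (fun f : a ⟶ b => f.hom.left) (by
    intro f g h
    ext1
    exact Over.OverMorphism.ext h)

instance (n : SimplexCategory) : FinCategory (LatchingIndex n) where
  fintypeObj := Fintype.ofFinite _
  fintypeHom _ _ := Fintype.ofFinite _

section Latching

variable {C : Type u} [Category.{v} C] [HasFiniteColimits C]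

/-- The diagram `([k] ⟶ [n]) ↦ A^k` whose colimit is the latching object. -/
abbrev latchingDiagram (A : SimplexCategory ⥤ C) (n : SimplexCategory) : LatchingIndex n ⥤ C :=
  ObjectProperty.ι _ ⋙ Over.forget n ⋙ A

/-- The latching object `L_n A`. -/
abbrev latchingObj (A : SimplexCategory ⥤ C) (n : SimplexCategory) : C :=
  colimit (latchingDiagram A n)

/-- The latching map `L_n A ⟶ A^n`. -/
def latchingMap (A : SimplexCategory ⥤ C) (n : SimplexCategory) : latchingObj A n ⟶ A.obj n :=
  colimit.desc (latchingDiagram A n)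
    { pt := A.obj n
      ι := { app := fun f => A.map f.obj.hom
             naturality := fun f g φ => by
               have h : A.map φ.hom.left ≫ A.map g.obj.hom = A.map f.obj.hom := by
                 rw [← A.map_comp, Over.w]
               exact h.trans (Category.comp_id _).symm } }

/-- The map `L_n A ⟶ L_n B` induced by `φ : A ⟶ B`. -/
def latchingObjMap {A B : SimplexCategory ⥤ C} (φ : A ⟶ B) (n : SimplexCategory) :
    latchingObj A n ⟶ latchingObj B n :=
  colimMap (Functor.whiskerLeft (ObjectProperty.ι _ ⋙ Over.forget n) φ)

lemma latchingObjMap_comp {A B : SimplexCategory ⥤ C} (φ : A ⟶ B) (n : SimplexCategory) :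
    latchingObjMap φ n ≫ latchingMap B n = latchingMap A n ≫ φ.app n := by
  refine colimit.hom_ext fun f => ?_
  have h₁ : colimit.ι (latchingDiagram A n) f ≫ latchingObjMap φ n =
      φ.app f.obj.left ≫ colimit.ι (latchingDiagram B n) f := ι_colimMap _ _
  have h₂ : colimit.ι (latchingDiagram B n) f ≫ latchingMap B n = B.map f.obj.hom :=
    colimit.ι_desc _ _
  have h₃ : colimit.ι (latchingDiagram A n) f ≫ latchingMap A n = A.map f.obj.hom :=
    colimit.ι_desc _ _
  rw [reassoc_of% h₁, reassoc_of% h₃]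
  exact (Category.assoc _ _ _).trans
    ((congrArg (φ.app f.obj.left ≫ ·) h₂).trans (φ.naturality f.obj.hom).symm)

/-- The relative latching map `L_n B ⊔_{L_n A} A^n ⟶ B^n` of `φ : A ⟶ B`. -/
def relativeLatchingMap {A B : SimplexCategory ⥤ C} (φ : A ⟶ B) (n : SimplexCategory) :
    pushout (latchingObjMap φ n) (latchingMap A n) ⟶ B.obj n :=
  pushout.desc (latchingMap B n) (φ.app n) (latchingObjMap_comp φ n)

/-! ### Cosimplicial frames and mapping spaces -/

/-- The cosimplicial object `ℓ^• X`: the left adjoint of evaluation in degree `0`, applied to `X`.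
Its `n`-th level is the coproduct of copies of `X` indexed by the `n + 1` maps `[0] ⟶ [n]`. -/
abbrev ellObj (X : C) : SimplexCategory ⥤ C := (evaluationLeftAdjoint C ⦋0⦌).obj X

/-- The constant cosimplicial object `r^• X`. -/
abbrev constObj (X : C) : SimplexCategory ⥤ C := (Functor.const SimplexCategory).obj X

/-- The canonical map `ℓ^• X ⟶ r^• X`, the fold map in each degree. -/
def foldMap (X : C) : ellObj X ⟶ constObj X where
  app n := Sigma.desc (fun _ : ⦋0⦌ ⟶ n => 𝟙 X)
  naturality m n f := by
    refine Sigma.hom_ext _ _ fun g => ?_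
    have h (k : SimplexCategory) (t : ⦋0⦌ ⟶ k) : Sigma.ι (fun _ : ⦋0⦌ ⟶ k => X) t ≫
        Sigma.desc (fun _ : ⦋0⦌ ⟶ k => 𝟙 X) = 𝟙 X := Sigma.ι_desc _ _
    have h' : Sigma.ι (fun _ : ⦋0⦌ ⟶ m => X) g ≫ (ellObj X).map f =
        Sigma.ι (fun _ : ⦋0⦌ ⟶ n => X) (g ≫ f) := Sigma.ι_desc _ _
    calc Sigma.ι (fun _ : ⦋0⦌ ⟶ m => X) g ≫ (ellObj X).map f ≫
          Sigma.desc (fun _ : ⦋0⦌ ⟶ n => 𝟙 X)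
        _ = Sigma.ι (fun _ : ⦋0⦌ ⟶ n => X) (g ≫ f) ≫
          Sigma.desc (fun _ : ⦋0⦌ ⟶ n => 𝟙 X) := by rw [← h']; exact (Category.assoc _ _ _).symm
        _ = Sigma.ι (fun _ : ⦋0⦌ ⟶ m => X) g ≫
          Sigma.desc (fun _ : ⦋0⦌ ⟶ m => 𝟙 X) ≫ 𝟙 X := by rw [h, Category.comp_id, h]

end Latching

section MappingSpaces

variable {C : Type u} [Category.{v} C] [ModelCategory C]

/-- A morphism of cosimplicial objects in a model category is a Reedy cofibration if all its
relative latching maps are cofibrations. -/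
def IsReedyCofibration {A B : SimplexCategory ⥤ C} (φ : A ⟶ B) : Prop :=
  ∀ n : SimplexCategory, Cofibration (relativeLatchingMap φ n)

/-- A cosimplicial frame for `X`: a factorisation `ℓ^• X ⟶ X^• ⟶ r^• X` of the canonical map into
a Reedy cofibration followed by a Reedy (that is, levelwise) weak equivalence. -/
structure CosimplicialFrame (X : C) where
  /-- the cosimplicial object `X^•` -/
  obj : SimplexCategory ⥤ C
  /-- the map `ℓ^• X ⟶ X^•` -/
  i : ellObj X ⟶ obj
  /-- the map `X^• ⟶ r^• X` -/
  p : obj ⟶ constObj X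
  fac : i ≫ p = foldMap X
  isReedyCofibration_i : IsReedyCofibration i
  weakEquivalence_p : ∀ n : SimplexCategory, WeakEquivalence (p.app n)

/-- A fibrant replacement of `Y`: a trivial cofibration `Y ⟶ Y^fib` with `Y^fib` fibrant. -/
structure FibrantReplacement (Y : C) where
  /-- the object `Y^fib` -/
  obj : C
  /-- the map `Y ⟶ Y^fib` -/
  ι : Y ⟶ obj
  cofibration_ι : Cofibration ι
  weakEquivalence_ι : WeakEquivalence ι
  isFibrant_obj : IsFibrant obj

/-- The simplicial set `C(A^•, Z)` with `n`-simplices the morphisms `A^n ⟶ Z`. -/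
def homSSet (A : SimplexCategory ⥤ C) (Z : C) : SSet.{v} :=
  Functor.op A ⋙ yoneda.obj Z

/-- The choices made in the definition of the mapping space `map(X, Y)`: a cosimplicial frame for
the source and a fibrant replacement of the target. -/
structure MappingSpaceChoice (X Y : C) where
  /-- the frame `X^•` -/
  frame : CosimplicialFrame X
  /-- the fibrant replacement `Y^fib` -/
  fib : FibrantReplacement Y

/-- The mapping space `map(X, Y) = C(X^•, Y^fib)` for the given choices. -/
def MappingSpaceChoice.map {X Y : C} (c : MappingSpaceChoice X Y) : SSet.{v} :=
  homSSet c.frame.obj c.fib.obj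

end MappingSpaces

end CosimplicialFrames

/-! ### Quillen adjunctions and Quillen equivalences -/

namespace QuillenPairs

variable {C : Type u₁} {D : Type u₂} [Category.{v} C] [Category.{v} D]
  [ModelCategory C] [ModelCategory D] {L : C ⥤ D} {R : D ⥤ C}

/-- The adjunction `L ⊣ R` is a Quillen adjunction: the left adjoint preserves cofibrations and
trivial cofibrations. -/
structure IsQuillenAdjunction (adj : L ⊣ R) : Prop where
  cofibration_map {A B : C} (f : A ⟶ B) : Cofibration f → Cofibration (L.map f)
  weakEquivalence_map {A B : C} (f : A ⟶ B) :
    Cofibration f → WeakEquivalence f → WeakEquivalence (L.map f)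

/-- The Quillen adjunction `L ⊣ R` is a Quillen equivalence: for `X` cofibrant and `Y` fibrant, a
map `L X ⟶ Y` is a weak equivalence if and only if its adjoint `X ⟶ R Y` is. -/
structure IsQuillenEquivalence (adj : L ⊣ R) : Prop extends IsQuillenAdjunction adj where
  weakEquivalence_iff (X : C) (Y : D) (f : L.obj X ⟶ Y) : IsCofibrant X → IsFibrant Y →
    (WeakEquivalence f ↔ WeakEquivalence (adj.homEquiv X Y f))

end QuillenPairs

end

noncomputable section

/-! ### Extending compatible families along latching maps -/

namespace CosimplicialFrames

/-! The comparison rests on two facts. If $A^\bullet$ is Reedy cofibrant, then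
$\mathcal{C}(A^\bullet,-)$ sends trivial fibrations to trivial Kan fibrations. If $Z$ is fibrant,
then $\mathcal{C}(-,Z)$ sends Reedy cofibrations that are levelwise weak equivalences to trivial Kan
fibrations. All comparisons of mapping spaces are zigzags of such maps and isomorphisms, so all that
is needed about $\mathrm{Ho}(\mathrm{sSet})$ is `weakHomotopyEquivalences_of_rlp_I`.

By Brown's factorisation, the first fact gives independence of the fibrant replacement. For
independence of the resolution, let $A$ and $B$ be Reedy cofibrant and levelwise weakly equivalent
to the constant object $W$. Factor $A\sqcup B\to W$ as a Reedy cofibration followed by a levelwise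
weak equivalence. By two-out-of-three both summands include by Reedy trivial cofibrations
(`isoInHo_homSSet_of_resolutions`). For a Quillen adjunction, $L(X^\bullet)$ is Reedy cofibrant and,
by Ken Brown's lemma, resolves $LX$, while
$\mathcal{C}(X^\bullet,RZ)\cong\mathcal{D}(LX^\bullet,Z)$; this gives (1). For (2), the adjoint
$X'\to R((LX')^{\mathrm{fib}})$ of the replacement map is a weak equivalence to a fibrant object.

The Reedy theory is phrased through `LatchLift`: lifting against one map $p$, with the latching
object replaced by compatible families on proper faces. Closure under composition, coproducts and
left adjoints then needs no comparison of colimits. The factorisation is required only over a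
constant object $W$. In the category over $W$ that object is terminal, and a levelwise contractible
object is built by attaching, in each degree $n$, cells that turn the matching map into a trivial
fibration. -/

/-- Compatible families over a finite-dimensional index set can be built degree by degree. -/
theorem exists_section {J : Type*} (Hom : J → J → Type*) (F : J → Type*)
    (r : ∀ {i j : J}, Hom i j → F j → F i) (deg : J → ℕ)
    (hdeg : ∀ {i j : J} (f : Hom i j), deg i < deg j ∨ ∃ h : i = j, ∀ x : F j, r f x = h ▸ x)
    (Good : ∀ j, F j → Prop)
    (H : ∀ (j : J) (y : ∀ i, deg i < deg j → F i), (∀ i hi, Good i (y i hi)) →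
      (∀ i i' (f : Hom i i') hi hi', r f (y i' hi') = y i hi) →
      ∃ x, Good j x ∧ ∀ i (f : Hom i j) hi, r f x = y i hi)
    (N : ℕ) (hN : ∀ j, deg j < N) :
    ∃ s : ∀ j, F j, (∀ j, Good j (s j)) ∧ ∀ i j (f : Hom i j), r f (s j) = s i := by
  have key : ∀ N : ℕ, ∃ s : ∀ j, deg j < N → F j, (∀ j hj, Good j (s j hj)) ∧
      ∀ i j (f : Hom i j) hi hj, r f (s j hj) = s i hi := by
    intro N
    induction N with
    | zero =>
      exact ⟨fun j hj => absurd hj (by simp), fun j hj => absurd hj (by simp),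
        fun i j f hi => absurd hi (by simp)⟩
    | succ N ih =>
      obtain ⟨s, hs, hs'⟩ := ih
      have ex : ∀ j, deg j = N → ∃ x, Good j x ∧ ∀ i (f : Hom i j) (hi : deg i < N),
          r f x = s i hi := by
        rintro j rfl
        exact H j s hs hs'
      -- The values in degree `N` can be chosen independently, since the only relations between
      -- indices of equal degree are trivial ones.
      choose x hx hx' using ex
      have cases' : ∀ j, deg j < N + 1 → ¬ deg j < N → deg j = N := fun j h h' => by omega
      refine ⟨fun j hj => if h : deg j < N then s j h else x j (cases' j hj h), ?_, ?_⟩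
      · intro j hj
        by_cases h : deg j < N
        · simpa [h] using hs j h
        · simpa [h] using hx j _
      · intro i j f hi hj
        obtain hlt | ⟨rfl, hf⟩ := hdeg f
        · have hi' : deg i < N := by omega
          by_cases h : deg j < N
          · simpa [h, hi'] using hs' i j f _ _
          · simpa [h, hi'] using hx' j _ i f _
        · exact hf _
  obtain ⟨s, hs, hs'⟩ := key N
  exact ⟨fun j => s j (hN j), fun j => hs j _, fun i j f => hs' i j f _ _⟩

/-- An injective endomorphism of `[k]` is the identity, so faces of equal dimension are related only
by identities. This is the degree condition for `exists_section`. -/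
lemma LatchingIndex.len_lt_or_eq {n : SimplexCategory} {f g : LatchingIndex n} (θ : f ⟶ g) :
    f.obj.left.len < g.obj.left.len ∨ ∃ h : f = g, θ = eqToHom h := by
  have : Mono f.obj.hom := f.property.1
  have : Mono θ.hom.left := by
    have : Mono (θ.hom.left ≫ g.obj.hom) := by rw [Over.w]; infer_instance
    exact mono_of_mono θ.hom.left g.obj.hom
  obtain hlt | heq := (SimplexCategory.len_le_of_mono θ.hom.left).lt_or_eq
  · exact Or.inl hlt
  · right
    obtain ⟨⟨k, ⟨⟨⟩⟩, f⟩, hf⟩ := f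
    obtain ⟨⟨l, ⟨⟨⟩⟩, g⟩, hg⟩ := g
    obtain rfl : k = l := by ext; exact heq
    have hθ : θ.hom.left = 𝟙 k := SimplexCategory.eq_id_of_mono _
    have hw := Over.w θ.hom
    rw [hθ] at hw
    have hfg : g = f := (Category.id_comp _).symm.trans hw
    subst hfg
    refine ⟨rfl, ?_⟩
    ext1
    exact Over.OverMorphism.ext hθ

lemma LatchingIndex.len_lt {n : SimplexCategory} (f : LatchingIndex n) :
    f.obj.left.len < n.len := by
  have : Mono f.obj.hom := f.property.1
  refine (SimplexCategory.len_le_of_mono f.obj.hom).lt_of_ne fun h => f.property.2 ?_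
  obtain ⟨⟨k, ⟨⟨⟩⟩, f⟩, hf⟩ := f
  obtain rfl : k = n := by ext; exact h
  have : f = 𝟙 k := SimplexCategory.eq_id_of_mono (f : k ⟶ k)
  change IsIso f
  rw [this]; exact inferInstanceAs (IsIso (𝟙 k))

/-- The object of the latching category given by a noninvertible monomorphism. -/
abbrev LatchingIndex.mk {n k : SimplexCategory} (f : k ⟶ n) (hf : Mono f) (hf' : ¬ IsIso f) :
    LatchingIndex n := ⟨Over.mk f, hf, hf'⟩

/-- A morphism in the latching category. -/
abbrev LatchingIndex.homMk {n : SimplexCategory} {f g : LatchingIndex n}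
    (θ : f.obj.left ⟶ g.obj.left) (h : θ ≫ g.obj.hom = f.obj.hom) : f ⟶ g :=
  ObjectProperty.homMk (Over.homMk θ h)

/-- Composition of a proper face with a face. -/
abbrev LatchingIndex.comp {n : SimplexCategory} (f : LatchingIndex n)
    (κ : LatchingIndex f.obj.left) : LatchingIndex n :=
  .mk (κ.obj.hom ≫ f.obj.hom)
    (by have := f.property.1; have := κ.property.1; exact mono_comp _ _)
    (fun h => by
      have : Mono f.obj.hom := f.property.1
      have := κ.property.1
      have h2 := SimplexCategory.len_le_of_epi (κ.obj.hom ≫ f.obj.hom)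
      have h1 := κ.len_lt
      have h3 := f.len_lt
      omega)

section

variable {C : Type u} [Category.{v} C]

/-- The relative latching map of `φ : A ⟶ B` at `n` has the left lifting property with respect
to `p`, expressed in terms of compatible families on the proper faces. -/
def LatchLift {A B : SimplexCategory ⥤ C} (φ : A ⟶ B) {Z Z' : C} (p : Z ⟶ Z')
    (n : SimplexCategory) : Prop :=
  ∀ (a : A.obj n ⟶ Z) (b : B.obj n ⟶ Z') (y : ∀ f : LatchingIndex n, B.obj f.obj.left ⟶ Z),
    a ≫ p = φ.app n ≫ b →
    (∀ {f g : LatchingIndex n} (θ : f ⟶ g), B.map θ.hom.left ≫ y g = y f) →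
    (∀ f, φ.app _ ≫ y f = A.map f.obj.hom ≫ a) →
    (∀ f, y f ≫ p = B.map f.obj.hom ≫ b) →
    ∃ h : B.obj n ⟶ Z, φ.app n ≫ h = a ∧ h ≫ p = b ∧ ∀ f, B.map f.obj.hom ≫ h = y f

/-- The relative latching map of a composite is a cobase change of that of `φ` followed by that of
`ψ`: extend over `B` first, then over `D`. -/
lemma LatchLift.comp {A B D : SimplexCategory ⥤ C} {φ : A ⟶ B} {ψ : B ⟶ D} {Z Z' : C}
    {p : Z ⟶ Z'} {n : SimplexCategory} (hφ : LatchLift φ p n) (hψ : LatchLift ψ p n) :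
    LatchLift (φ ≫ ψ) p n := by
  intro a b y hab hy hya hyb
  obtain ⟨h', h1, h2, h3⟩ := hφ a (ψ.app n ≫ b) (fun f => ψ.app _ ≫ y f) (by simp [hab])
    (fun θ => by rw [← hy θ]; simp) (fun f => by simp [← hya f])
    (fun f => by simp [hyb f])
  obtain ⟨h, h4, h5, h6⟩ := hψ h' b y h2 hy (fun f => (h3 f).symm) hyb
  exact ⟨h, by simp [h1, h4], h5, h6⟩

lemma latchLift_of_isIso {A B : SimplexCategory ⥤ C} (φ : A ⟶ B) {Z Z' : C}
    (p : Z ⟶ Z') (n : SimplexCategory)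
    (h : ∀ k : SimplexCategory, k.len ≤ n.len → IsIso (φ.app k)) :
    LatchLift φ p n := by
  intro a b y hab hy hya hyb
  have := h n le_rfl
  refine ⟨inv (φ.app n) ≫ a, by simp, by simp [hab], fun f => ?_⟩
  have := h _ f.len_lt.le
  rw [← cancel_epi (φ.app _), hya, ← φ.naturality_assoc]
  simp

/-- Induction on the dimension of faces: values already chosen on the faces of a face `f` form a
compatible family there, and `LatchLift` in the dimension of `f` extends it. -/
lemma exists_latching_lift {A B : SimplexCategory ⥤ C} (φ : A ⟶ B) {Z Z' : C} (p : Z ⟶ Z')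
    (n : SimplexCategory) (H : ∀ k : SimplexCategory, k.len < n.len → LatchLift φ p k)
    (a : ∀ f : LatchingIndex n, A.obj f.obj.left ⟶ Z)
    (b : ∀ f : LatchingIndex n, B.obj f.obj.left ⟶ Z')
    (ha : ∀ {f g : LatchingIndex n} (θ : f ⟶ g), A.map θ.hom.left ≫ a g = a f)
    (hb : ∀ {f g : LatchingIndex n} (θ : f ⟶ g), B.map θ.hom.left ≫ b g = b f)
    (hab : ∀ f, a f ≫ p = φ.app _ ≫ b f) :
    ∃ y : ∀ f : LatchingIndex n, B.obj f.obj.left ⟶ Z,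
      (∀ {f g : LatchingIndex n} (θ : f ⟶ g), B.map θ.hom.left ≫ y g = y f) ∧
      ∀ f, φ.app _ ≫ y f = a f ∧ y f ≫ p = b f := by
  obtain ⟨y, hy, hy'⟩ := exists_section (fun f g : LatchingIndex n => f ⟶ g)
    (fun f => B.obj f.obj.left ⟶ Z) (fun {f g} θ x => B.map θ.hom.left ≫ x)
    (fun f => f.obj.left.len)
    (fun {f g} θ => by
      obtain h | ⟨rfl, rfl⟩ := LatchingIndex.len_lt_or_eq θ
      · exact Or.inl h
      · exact Or.inr ⟨rfl, fun x => by simp⟩)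
    (fun f x => φ.app _ ≫ x = a f ∧ x ≫ p = b f)
    (fun f y hy hy' => by
      obtain ⟨x, h1, h2, h3⟩ := H _ f.len_lt (a f) (b f)
        (fun κ => y (f.comp κ) κ.len_lt) (hab f)
        (fun {κ κ'} θ => hy' (f.comp κ) (f.comp κ')
          (LatchingIndex.homMk θ.hom.left (by simp)) _ _)
        (fun κ => (hy (f.comp κ) κ.len_lt).1.trans
          (ha (f := f.comp κ) (g := f) (LatchingIndex.homMk κ.obj.hom rfl)).symm)
        (fun κ => (hy (f.comp κ) κ.len_lt).2.trans
          (hb (f := f.comp κ) (g := f) (LatchingIndex.homMk κ.obj.hom rfl)).symm)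
      refine ⟨x, ⟨h1, h2⟩, fun g θ hg => ?_⟩
      have hθ : Mono θ.hom.left := by
        have := g.property.1
        have : Mono (θ.hom.left ≫ f.obj.hom) := by rw [Over.w]; infer_instance
        exact mono_of_mono θ.hom.left f.obj.hom
      let κ : LatchingIndex f.obj.left := .mk θ.hom.left hθ (fun h => by
        have := SimplexCategory.len_le_of_epi θ.hom.left
        omega)
      -- The indices `g` and `f.comp κ` have the same source and propositionally equal maps, so they
      -- are compared along the morphism over the identity.
      rw [← hy' g (f.comp κ) (LatchingIndex.homMk (𝟙 _) (by simp [κ])) hg κ.len_lt]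
      exact (h3 κ).trans (by
        simp only [ObjectProperty.homMk_hom, Over.homMk_left]
        exact ((congrArg (· ≫ _) (B.map_id _)).trans (Category.id_comp _)).symm))
    n.len (fun f => f.len_lt)
  exact ⟨y, fun θ => hy' _ _ θ, hy⟩

lemma LatchLift.hasLiftingProperty_app {A B : SimplexCategory ⥤ C} {φ : A ⟶ B} {Z Z' : C}
    {p : Z ⟶ Z'} (n : SimplexCategory)
    (H : ∀ k : SimplexCategory, k.len ≤ n.len → LatchLift φ p k) :
    HasLiftingProperty (φ.app n) p where
  sq_hasLift {a b} sq := by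
    obtain ⟨y, hy, hy'⟩ := exists_latching_lift φ p n (fun k hk => H k hk.le)
      (fun f => A.map f.obj.hom ≫ a) (fun f => B.map f.obj.hom ≫ b)
      (fun θ => by rw [← A.map_comp_assoc, Over.w]) (fun θ => by rw [← B.map_comp_assoc, Over.w])
      (fun f => by simp [sq.w])
    obtain ⟨h, h1, h2, -⟩ := H n le_rfl a b y sq.w hy (fun f => (hy' f).1) (fun f => (hy' f).2)
    exact ⟨⟨h, h1, h2⟩⟩

/-- `LatchLift` mentions only maps out of levels, so every datum and equation transposes across the
adjunction. -/
lemma latchLift_map_of_adjunction {D : Type u₁} [Category.{v} D] {L : C ⥤ D} {R : D ⥤ C}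
    (adj : L ⊣ R) {A B : SimplexCategory ⥤ C} {φ : A ⟶ B} {Z Z' : D} {p : Z ⟶ Z'}
    {n : SimplexCategory} (H : LatchLift φ (R.map p) n) :
    LatchLift (Functor.whiskerRight φ L) p n := by
  intro a b y hab hy hya hyb
  obtain ⟨h, h1, h2, h3⟩ := H (adj.homEquiv _ _ a) (adj.homEquiv _ _ b)
    (fun f => adj.homEquiv _ _ (y f))
    (by
      rw [← adj.homEquiv_naturality_right, hab]
      exact adj.homEquiv_naturality_left _ _)
    (fun θ => by
      rw [← adj.homEquiv_naturality_left]
      exact congrArg _ (hy θ))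
    (fun f => by
      rw [← adj.homEquiv_naturality_left, ← adj.homEquiv_naturality_left]
      exact congrArg _ (hya f))
    (fun f => by
      rw [← adj.homEquiv_naturality_right, ← adj.homEquiv_naturality_left]
      exact congrArg _ (hyb f))
  refine ⟨(adj.homEquiv _ _).symm h, ?_, ?_, fun f => ?_⟩
  · apply (adj.homEquiv _ _).injective
    rw [← h1]
    exact (adj.homEquiv_naturality_left _ _).trans (by simp)
  · apply (adj.homEquiv _ _).injective
    rw [← h2]
    exact (adj.homEquiv_naturality_right _ _).trans (by simp)
  · apply (adj.homEquiv _ _).injective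
    rw [← h3]
    exact (adj.homEquiv_naturality_left _ _).trans (by simp)

end

/-! ### Reedy cofibrations and lifting of compatible families -/

section

variable {C : Type u} [Category.{v} C] [HasFiniteColimits C]

/-- The inclusion of a face in the latching object. -/
def latchingι (A : SimplexCategory ⥤ C) {n : SimplexCategory} (f : LatchingIndex n) :
    A.obj f.obj.left ⟶ latchingObj A n :=
  colimit.ι (latchingDiagram A n) f

lemma latching_hom_ext {A : SimplexCategory ⥤ C} {n : SimplexCategory} {Z : C}
    {x y : latchingObj A n ⟶ Z} (h : ∀ f, latchingι A f ≫ x = latchingι A f ≫ y) : x = y :=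
  colimit.hom_ext h

lemma latchingι_latchingMap (A : SimplexCategory ⥤ C) {n : SimplexCategory}
    (f : LatchingIndex n) : latchingι A f ≫ latchingMap A n = A.map f.obj.hom :=
  colimit.ι_desc _ _

lemma latchingι_latchingObjMap {A B : SimplexCategory ⥤ C} (φ : A ⟶ B) {n : SimplexCategory}
    (f : LatchingIndex n) :
    latchingι A f ≫ latchingObjMap φ n = φ.app f.obj.left ≫ latchingι B f :=
  ι_colimMap _ _

/-- The map out of the latching object given by a compatible family. -/
def latchingDesc {A : SimplexCategory ⥤ C} {n : SimplexCategory} {Z : C}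
    (y : ∀ f : LatchingIndex n, A.obj f.obj.left ⟶ Z)
    (hy : ∀ (f g : LatchingIndex n) (θ : f ⟶ g), A.map θ.hom.left ≫ y g = y f) :
    latchingObj A n ⟶ Z :=
  colimit.desc (latchingDiagram A n)
    { pt := Z
      ι := { app := y
             naturality := fun _ _ θ => (hy _ _ θ).trans (Category.comp_id _).symm } }

lemma latchingι_latchingDesc {A : SimplexCategory ⥤ C} {n : SimplexCategory} {Z : C}
    (y : ∀ f : LatchingIndex n, A.obj f.obj.left ⟶ Z)
    (hy : ∀ (f g : LatchingIndex n) (θ : f ⟶ g), A.map θ.hom.left ≫ y g = y f)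
    (f : LatchingIndex n) : latchingι A f ≫ latchingDesc y hy = y f :=
  colimit.ι_desc _ _

lemma map_latchingι (A : SimplexCategory ⥤ C) {n : SimplexCategory} {f g : LatchingIndex n}
    (θ : f ⟶ g) : A.map θ.hom.left ≫ latchingι A g = latchingι A f :=
  colimit.w (latchingDiagram A n) θ

lemma inl_relativeLatchingMap {A B : SimplexCategory ⥤ C} (φ : A ⟶ B) (n : SimplexCategory) :
    pushout.inl (latchingObjMap φ n) (latchingMap A n) ≫ relativeLatchingMap φ n =
      latchingMap B n :=
  pushout.inl_desc _ _ _

lemma inr_relativeLatchingMap {A B : SimplexCategory ⥤ C} (φ : A ⟶ B) (n : SimplexCategory) :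
    pushout.inr (latchingObjMap φ n) (latchingMap A n) ≫ relativeLatchingMap φ n = φ.app n :=
  pushout.inr_desc _ _ _

/-- By the universal properties of the latching object and the pushout, a commutative square from
the relative latching map to `p` is exactly a triple `(a, b, y)`. -/
lemma latchLift_iff {A B : SimplexCategory ⥤ C} (φ : A ⟶ B) {Z Z' : C} (p : Z ⟶ Z')
    (n : SimplexCategory) :
    LatchLift φ p n ↔ HasLiftingProperty (relativeLatchingMap φ n) p := by
  constructor
  · intro H
    refine ⟨fun {t b} sq => ?_⟩
    obtain ⟨h, h1, h2, h3⟩ := H (pushout.inr _ _ ≫ t) b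
      (fun f => latchingι B f ≫ pushout.inl _ _ ≫ t)
      (by rw [Category.assoc, sq.w, reassoc_of% inr_relativeLatchingMap])
      (fun θ => by rw [reassoc_of% map_latchingι])
      (fun f => by
        rw [← reassoc_of% latchingι_latchingObjMap, pushout.condition_assoc,
          reassoc_of% latchingι_latchingMap])
      (fun f => by
        rw [Category.assoc, Category.assoc, sq.w, reassoc_of% inl_relativeLatchingMap,
          reassoc_of% latchingι_latchingMap])
    refine ⟨⟨h, ?_, h2⟩⟩
    apply pushout.hom_ext
    · refine latching_hom_ext fun f => ?_
      rw [reassoc_of% inl_relativeLatchingMap, reassoc_of% latchingι_latchingMap, h3]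
    · rw [reassoc_of% inr_relativeLatchingMap, h1]
  · intro H a b y hab hy hya hyb
    have sq : CommSq (pushout.desc (latchingDesc y fun _ _ => hy) a (by
        refine latching_hom_ext fun f => ?_
        rw [reassoc_of% latchingι_latchingObjMap, latchingι_latchingDesc,
          reassoc_of% latchingι_latchingMap, hya]))
        (relativeLatchingMap φ n) p b := ⟨by
      apply pushout.hom_ext
      · refine latching_hom_ext fun f => ?_
        rw [pushout.inl_desc_assoc, reassoc_of% inl_relativeLatchingMap,
          reassoc_of% latchingι_latchingDesc, reassoc_of% latchingι_latchingMap, hyb]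
      · rw [pushout.inr_desc_assoc, reassoc_of% inr_relativeLatchingMap, hab]⟩
    have fac := sq.fac_left
    refine ⟨sq.lift, ?_, sq.fac_right, fun f => ?_⟩
    · rw [← reassoc_of% inr_relativeLatchingMap, fac, pushout.inr_desc]
    · rw [← reassoc_of% latchingι_latchingMap, ← reassoc_of% inl_relativeLatchingMap, fac,
        pushout.inl_desc, latchingι_latchingDesc]

lemma hasLiftingProperty_latchingObjMap {A B : SimplexCategory ⥤ C} (φ : A ⟶ B) {Z Z' : C}
    (p : Z ⟶ Z') (n : SimplexCategory)
    (H : ∀ k : SimplexCategory, k.len < n.len → LatchLift φ p k) :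
    HasLiftingProperty (latchingObjMap φ n) p where
  sq_hasLift {a b} sq := by
    obtain ⟨y, hy, hy'⟩ := exists_latching_lift φ p n H
      (fun f => latchingι A f ≫ a) (fun f => latchingι B f ≫ b)
      (fun θ => by rw [reassoc_of% map_latchingι]) (fun θ => by rw [reassoc_of% map_latchingι])
      (fun f => by rw [Category.assoc, sq.w, reassoc_of% latchingι_latchingObjMap])
    refine ⟨⟨latchingDesc y fun _ _ => hy, ?_, ?_⟩⟩
    · refine latching_hom_ext fun f => ?_
      rw [reassoc_of% latchingι_latchingObjMap, latchingι_latchingDesc, (hy' f).1]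
    · refine latching_hom_ext fun f => ?_
      rw [reassoc_of% latchingι_latchingDesc, (hy' f).2]

end

/-! ### Reedy cofibrations in a model category -/

section

variable {C : Type u} [Category.{v} C] [ModelCategory C]

lemma cofibration_of_hasLiftingProperty {X Y : C} (i : X ⟶ Y)
    (h : ∀ {Z Z' : C} (p : Z ⟶ Z'), Fibration p → WeakEquivalence p → HasLiftingProperty i p) :
    Cofibration i := by
  rw [cofibration_iff, ← trivialFibrations_llp]
  intro Z Z' p hp
  rw [mem_trivialFibrations_iff] at hp
  exact h p hp.1 hp.2

lemma trivialCofibration_of_hasLiftingProperty {X Y : C} (i : X ⟶ Y)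
    (h : ∀ {Z Z' : C} (p : Z ⟶ Z'), Fibration p → HasLiftingProperty i p) :
    Cofibration i ∧ WeakEquivalence i := by
  rw [← mem_trivialCofibrations_iff, ← fibrations_llp]
  intro Z Z' p hp
  exact h p ((fibration_iff p).2 hp)

lemma trivialFibration_of_hasLiftingProperty {X Y : C} (p : X ⟶ Y)
    (h : ∀ {Z Z' : C} (i : Z ⟶ Z'), Cofibration i → HasLiftingProperty i p) :
    Fibration p ∧ WeakEquivalence p := by
  rw [← mem_trivialFibrations_iff, ← cofibrations_rlp]
  intro Z Z' i hi
  exact h i ((cofibration_iff i).2 hi)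

lemma fibration_of_hasLiftingProperty {X Y : C} (p : X ⟶ Y)
    (h : ∀ {Z Z' : C} (i : Z ⟶ Z'), Cofibration i → WeakEquivalence i → HasLiftingProperty i p) :
    Fibration p := by
  rw [fibration_iff, ← trivialCofibrations_rlp]
  intro Z Z' i hi
  rw [mem_trivialCofibrations_iff] at hi
  exact h i hi.1 hi.2

lemma isReedyCofibration_iff {A B : SimplexCategory ⥤ C} (φ : A ⟶ B) :
    IsReedyCofibration φ ↔ ∀ {Z Z' : C} (p : Z ⟶ Z'), Fibration p → WeakEquivalence p →
      ∀ n, LatchLift φ p n := by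
  constructor
  · intro H Z Z' p _ _ n
    have := H n
    rw [latchLift_iff]
    infer_instance
  · intro H n
    refine cofibration_of_hasLiftingProperty _ fun p h h' => ?_
    rw [← latchLift_iff]
    exact H p h h' n

lemma IsReedyCofibration.comp {A B D : SimplexCategory ⥤ C} {φ : A ⟶ B} {ψ : B ⟶ D}
    (hφ : IsReedyCofibration φ) (hψ : IsReedyCofibration ψ) : IsReedyCofibration (φ ≫ ψ) := by
  rw [isReedyCofibration_iff] at *
  exact fun p h h' n => (hφ p h h' n).comp (hψ p h h' n)

lemma IsReedyCofibration.cofibration_app {A B : SimplexCategory ⥤ C} {φ : A ⟶ B}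
    (hφ : IsReedyCofibration φ) (n : SimplexCategory) : Cofibration (φ.app n) := by
  rw [isReedyCofibration_iff] at hφ
  exact cofibration_of_hasLiftingProperty _ fun p h h' =>
    LatchLift.hasLiftingProperty_app n fun k _ => hφ p h h' k

/-- A Reedy cofibration which is a levelwise weak equivalence has relative latching maps with
the left lifting property with respect to all fibrations. -/
theorem IsReedyCofibration.latchLift_of_fibration {A B : SimplexCategory ⥤ C} {φ : A ⟶ B}
    (hφ : IsReedyCofibration φ) (hw : ∀ n, WeakEquivalence (φ.app n)) {Z Z' : C} (p : Z ⟶ Z')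
    [Fibration p] (n : SimplexCategory) : LatchLift φ p n := by
  -- The induction quantifies over all fibrations, because recognising the map of latching objects
  -- as a trivial cofibration requires lifting against each of them.
  suffices ∀ (N : ℕ) (n : SimplexCategory), n.len = N → ∀ {Z Z' : C} (p : Z ⟶ Z'),
      Fibration p → LatchLift φ p n from this _ n rfl p inferInstance
  intro N
  induction N using Nat.strong_induction_on with
  | _ N ih =>
    rintro n rfl Z Z' p _
    have := hφ n
    obtain ⟨_, _⟩ := trivialCofibration_of_hasLiftingProperty (latchingObjMap φ n)
      fun q hq => hasLiftingProperty_latchingObjMap φ q n fun k hk => ih k.len hk k rfl q hq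
    have := hw n
    -- The inclusion of `A^n` in the pushout is a cobase change of the trivial cofibration
    -- `latchingObjMap φ n`; two-out-of-three with `φ.app n` applies.
    have : WeakEquivalence (relativeLatchingMap φ n) :=
      weakEquivalence_of_precomp_of_fac (inr_relativeLatchingMap φ n)
    rw [latchLift_iff]
    infer_instance

/-- A cosimplicial object is Reedy cofibrant if the map from the initial object is a Reedy
cofibration. -/
abbrev IsReedyCofibrant (A : SimplexCategory ⥤ C) : Prop :=
  IsReedyCofibration
    ({ app := fun _ => initial.to _
       naturality := fun _ _ _ => initialIsInitial.hom_ext _ _ } :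
      (Functor.const SimplexCategory).obj (⊥_ C) ⟶ A)

lemma isReedyCofibrant_iff (A : SimplexCategory ⥤ C) :
    IsReedyCofibrant A ↔ ∀ {Z Z' : C} (p : Z ⟶ Z'), Fibration p → WeakEquivalence p →
      ∀ (n : SimplexCategory) (b : A.obj n ⟶ Z')
        (y : ∀ f : LatchingIndex n, A.obj f.obj.left ⟶ Z),
        (∀ {f g : LatchingIndex n} (θ : f ⟶ g), A.map θ.hom.left ≫ y g = y f) →
        (∀ f, y f ≫ p = A.map f.obj.hom ≫ b) →
        ∃ h : A.obj n ⟶ Z, h ≫ p = b ∧ ∀ f, A.map f.obj.hom ≫ h = y f := by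
  rw [IsReedyCofibrant, isReedyCofibration_iff]
  constructor
  · intro H Z Z' p h h' n b y hy hyb
    obtain ⟨h, -, h2, h3⟩ := H p h h' n (initial.to _) b y (initialIsInitial.hom_ext _ _) hy
      (fun f => initialIsInitial.hom_ext _ _) hyb
    exact ⟨h, h2, h3⟩
  · intro H Z Z' p h h' n a b y _ hy _ hyb
    obtain ⟨h, h2, h3⟩ := H p h h' n b y hy hyb
    exact ⟨h, initialIsInitial.hom_ext _ _, h2, h3⟩

lemma IsReedyCofibrant.isCofibrant {A : SimplexCategory ⥤ C} (hA : IsReedyCofibrant A)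
    (n : SimplexCategory) : IsCofibrant (A.obj n) :=
  IsReedyCofibration.cofibration_app hA n

lemma IsReedyCofibrant.of_isReedyCofibration {A B : SimplexCategory ⥤ C} {φ : A ⟶ B}
    (hA : IsReedyCofibrant A) (hφ : IsReedyCofibration φ) : IsReedyCofibrant B := by
  have := IsReedyCofibration.comp hA hφ
  convert this using 1
  ext n
  exact initialIsInitial.hom_ext _ _

/-- The inclusion of a copy of `X` in `ℓ^• X`. -/
def ellι (X : C) {n : SimplexCategory} (g : ⦋0⦌ ⟶ n) : X ⟶ (ellObj X).obj n :=
  Sigma.ι (fun _ : ⦋0⦌ ⟶ n => X) g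

lemma ellι_map (X : C) {k l : SimplexCategory} (g : ⦋0⦌ ⟶ k) (f : k ⟶ l) :
    ellι X g ≫ (ellObj X).map f = ellι X (g ≫ f) :=
  Sigma.ι_desc _ _

lemma ell_hom_ext {X : C} {n : SimplexCategory} {Z : C} {x y : (ellObj X).obj n ⟶ Z}
    (h : ∀ g : ⦋0⦌ ⟶ n, ellι X g ≫ x = ellι X g ≫ y) : x = y :=
  Sigma.hom_ext _ _ h

/-- The map out of a level of `ℓ^• X` given by a family of maps. -/
def ellDesc {X : C} {n : SimplexCategory} {Z : C} (v : (⦋0⦌ ⟶ n) → (X ⟶ Z)) :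
    (ellObj X).obj n ⟶ Z :=
  Sigma.desc v

lemma ellι_ellDesc {X : C} {n : SimplexCategory} {Z : C} (v : (⦋0⦌ ⟶ n) → (X ⟶ Z))
    (g : ⦋0⦌ ⟶ n) : ellι X g ≫ ellDesc v = v g :=
  Sigma.ι_desc _ _

/-- The copies of `X` in level `n` correspond to the vertices of `[n]`. A vertex that is a proper
face has its value prescribed; a new copy of `X` occurs only in degree `0`, where cofibrancy of `X`
supplies the lift. -/
lemma isReedyCofibrant_ellObj (X : C) [IsCofibrant X] : IsReedyCofibrant (ellObj X) := by
  rw [isReedyCofibrant_iff]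
  intro Z Z' p _ _ n b y hy hyb
  have hm {k : SimplexCategory} (g : ⦋0⦌ ⟶ k) : Mono g := by
    rw [SimplexCategory.mono_iff_injective]
    exact fun _ _ _ => Fin.subsingleton_one.elim _ _
  have key (g : ⦋0⦌ ⟶ n) : ∃ v : X ⟶ Z, v ≫ p = ellι X g ≫ b ∧
      ∀ hg : ¬ IsIso g, v = ellι X (𝟙 _) ≫ y (.mk g (hm g) hg) := by
    by_cases hg : IsIso g
    · have sq : CommSq (initial.to Z) (initial.to X) p (ellι X g ≫ b) :=
        ⟨initialIsInitial.hom_ext _ _⟩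
      exact ⟨sq.lift, sq.fac_right, fun h => absurd hg h⟩
    · refine ⟨ellι X (𝟙 _) ≫ y (.mk g (hm g) hg), ?_, fun _ => rfl⟩
      rw [Category.assoc, hyb, reassoc_of% ellι_map]
      exact congrArg (fun t => ellι X t ≫ b) (Category.id_comp _)
  choose v hv hv' using key
  refine ⟨ellDesc v, ?_, fun f => ?_⟩
  · refine ell_hom_ext fun g => ?_
    rw [reassoc_of% ellι_ellDesc, hv]
  · refine ell_hom_ext fun g => ?_
    have := hm g
    have hiso : ¬ IsIso (g ≫ f.obj.hom) := fun h => by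
      have h1 := SimplexCategory.len_le_of_epi (g ≫ f.obj.hom)
      have h2 := f.len_lt
      simp at h1
      omega
    rw [reassoc_of% ellι_map, ellι_ellDesc, hv' _ hiso,
      ← hy (f := .mk (g ≫ f.obj.hom) (hm _) hiso) (g := f) (LatchingIndex.homMk g rfl),
      reassoc_of% ellι_map]
    exact congrArg (fun t => ellι X t ≫ y f) (Category.id_comp _)

/-- The levelwise binary coproduct of cosimplicial objects. -/
def levelwiseCoprod (A B : SimplexCategory ⥤ C) : SimplexCategory ⥤ C where
  obj n := A.obj n ⨿ B.obj n
  map f := coprod.map (A.map f) (B.map f)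

/-- The first inclusion in the levelwise coproduct. -/
def levelwiseInl (A B : SimplexCategory ⥤ C) : A ⟶ levelwiseCoprod A B where
  app n := (coprod.inl : A.obj n ⟶ A.obj n ⨿ B.obj n)
  naturality _ _ _ := (coprod.inl_map _ _).symm

/-- The second inclusion in the levelwise coproduct. -/
def levelwiseInr (A B : SimplexCategory ⥤ C) : B ⟶ levelwiseCoprod A B where
  app n := (coprod.inr : B.obj n ⟶ A.obj n ⨿ B.obj n)
  naturality _ _ _ := (coprod.inr_map _ _).symm

/-- The map out of one level of the levelwise coproduct. -/
def levelDesc {A B : SimplexCategory ⥤ C} {n : SimplexCategory} {Z : C} (f : A.obj n ⟶ Z)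
    (g : B.obj n ⟶ Z) : (levelwiseCoprod A B).obj n ⟶ Z :=
  coprod.desc f g

@[simp]
lemma levelwiseInl_levelDesc {A B : SimplexCategory ⥤ C} {n : SimplexCategory} {Z : C}
    (f : A.obj n ⟶ Z) (g : B.obj n ⟶ Z) : (levelwiseInl A B).app n ≫ levelDesc f g = f :=
  coprod.inl_desc _ _

@[simp]
lemma levelwiseInr_levelDesc {A B : SimplexCategory ⥤ C} {n : SimplexCategory} {Z : C}
    (f : A.obj n ⟶ Z) (g : B.obj n ⟶ Z) : (levelwiseInr A B).app n ≫ levelDesc f g = g :=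
  coprod.inr_desc _ _

lemma level_hom_ext {A B : SimplexCategory ⥤ C} {n : SimplexCategory} {Z : C}
    {f g : (levelwiseCoprod A B).obj n ⟶ Z}
    (hl : (levelwiseInl A B).app n ≫ f = (levelwiseInl A B).app n ≫ g)
    (hr : (levelwiseInr A B).app n ≫ f = (levelwiseInr A B).app n ≫ g) : f = g :=
  coprod.hom_ext hl hr

/-- The map out of the levelwise coproduct. -/
def levelwiseDesc {A B E : SimplexCategory ⥤ C} (f : A ⟶ E) (g : B ⟶ E) :
    levelwiseCoprod A B ⟶ E where
  app n := levelDesc (f.app n) (g.app n)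
  naturality _ _ θ := by
    apply level_hom_ext
    · rw [← NatTrans.naturality_assoc, levelwiseInl_levelDesc, reassoc_of% levelwiseInl_levelDesc,
        f.naturality]
    · rw [← NatTrans.naturality_assoc, levelwiseInr_levelDesc, reassoc_of% levelwiseInr_levelDesc,
        g.naturality]

/-- This is a cobase change of the map from the initial object to `B`: the lift is prescribed on `A`
and exists on `B` by Reedy cofibrancy. -/
lemma isReedyCofibration_levelwiseInl (A : SimplexCategory ⥤ C) {B : SimplexCategory ⥤ C}
    (hB : IsReedyCofibrant B) : IsReedyCofibration (levelwiseInl A B) := by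
  rw [isReedyCofibration_iff]
  intro Z Z' p h h' n a b y hab hy hya hyb
  obtain ⟨h, h2, h3⟩ := (isReedyCofibrant_iff B).1 hB p h h' n ((levelwiseInr A B).app n ≫ b)
    (fun f => (levelwiseInr A B).app _ ≫ y f)
    (fun θ => by rw [← hy θ, NatTrans.naturality_assoc])
    (fun f => by rw [Category.assoc, hyb, NatTrans.naturality_assoc])
  refine ⟨levelDesc a h, by simp, ?_, fun f => ?_⟩
  · apply level_hom_ext
    · rw [reassoc_of% levelwiseInl_levelDesc, hab]
    · rw [reassoc_of% levelwiseInr_levelDesc, h2]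
  · apply level_hom_ext
    · rw [← NatTrans.naturality_assoc, levelwiseInl_levelDesc, hya]
    · rw [← NatTrans.naturality_assoc, levelwiseInr_levelDesc, h3]

lemma isReedyCofibration_levelwiseInr {A : SimplexCategory ⥤ C} (B : SimplexCategory ⥤ C)
    (hA : IsReedyCofibrant A) : IsReedyCofibration (levelwiseInr A B) := by
  rw [isReedyCofibration_iff]
  intro Z Z' p h h' n a b y hab hy hya hyb
  obtain ⟨h, h2, h3⟩ := (isReedyCofibrant_iff A).1 hA p h h' n ((levelwiseInl A B).app n ≫ b)
    (fun f => (levelwiseInl A B).app _ ≫ y f)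
    (fun θ => by rw [← hy θ, NatTrans.naturality_assoc])
    (fun f => by rw [Category.assoc, hyb, NatTrans.naturality_assoc])
  refine ⟨levelDesc h a, by simp, ?_, fun f => ?_⟩
  · apply level_hom_ext
    · rw [reassoc_of% levelwiseInl_levelDesc, h2]
    · rw [reassoc_of% levelwiseInr_levelDesc, hab]
  · apply level_hom_ext
    · rw [← NatTrans.naturality_assoc, levelwiseInl_levelDesc, h3]
    · rw [← NatTrans.naturality_assoc, levelwiseInr_levelDesc, hya]

end

/-! ### Attaching an object in one degree -/

section Attaching

variable {C : Type u} [Category.{v} C] [HasFiniteColimits C]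

/-- The data for attaching cells of dimension `n` to the cosimplicial object `E`: a map
`E^n ⟶ V` together with values in `E` of all noninjective structure maps out of `V`. -/
structure AttachingData (E : SimplexCategory ⥤ C) (n : SimplexCategory) where
  /-- the new `n`-th level -/
  V : C
  /-- the map to the new `n`-th level -/
  e : E.obj n ⟶ V
  /-- the structure maps along noninjective maps -/
  m : ∀ {k : SimplexCategory} (g : n ⟶ k), ¬ Mono g → (V ⟶ E.obj k)
  m_map : ∀ {k l : SimplexCategory} (g : n ⟶ k) (θ : k ⟶ l) (hg : ¬ Mono g)
    (hg' : ¬ Mono (g ≫ θ)), m g hg ≫ E.map θ = m (g ≫ θ) hg'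
  e_m : ∀ {k : SimplexCategory} (g : n ⟶ k) (hg : ¬ Mono g), e ≫ m g hg = E.map g

namespace AttachingData

variable {E : SimplexCategory ⥤ C} {n : SimplexCategory} (d : AttachingData E n)

/-- A level of the cosimplicial object obtained by attaching cells. -/
def level (k : SimplexCategory) : C :=
  pushout (Limits.Sigma.desc fun g : { g : n ⟶ k // Mono g } => E.map g.1)
    (Limits.Sigma.map fun _ : { g : n ⟶ k // Mono g } => d.e)

/-- The inclusion of the original cosimplicial object. -/
def inl (k : SimplexCategory) : E.obj k ⟶ d.level k := pushout.inl _ _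

/-- The inclusion of a cell. -/
def cell {k : SimplexCategory} (g : n ⟶ k) (hg : Mono g) : d.V ⟶ d.level k :=
  Sigma.ι (fun _ : { g : n ⟶ k // Mono g } => d.V) ⟨g, hg⟩ ≫
    (pushout.inr _ _ : _ ⟶ pushout _ (Limits.Sigma.map fun _ => d.e))

lemma e_cell {k : SimplexCategory} (g : n ⟶ k) (hg : Mono g) :
    d.e ≫ d.cell g hg = E.map g ≫ d.inl k := by
  have := Sigma.ι (fun _ : { g : n ⟶ k // Mono g } => E.obj n) ⟨g, hg⟩ ≫= pushout.condition
    (f := Limits.Sigma.desc fun g : { g : n ⟶ k // Mono g } => E.map g.1)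
    (g := Limits.Sigma.map fun _ : { g : n ⟶ k // Mono g } => d.e)
  rw [Sigma.ι_desc_assoc, Sigma.ι_map_assoc] at this
  exact this.symm

/-- A map out of a level is given by a map on `E` and on all cells. -/
def desc {k : SimplexCategory} {Z : C} (a : E.obj k ⟶ Z) (c : ∀ g : n ⟶ k, Mono g → (d.V ⟶ Z))
    (h : ∀ g hg, d.e ≫ c g hg = E.map g ≫ a) : d.level k ⟶ Z :=
  pushout.desc a (Limits.Sigma.desc fun g => c g.1 g.2) (by
    refine Sigma.hom_ext _ _ fun g => ?_
    rw [Sigma.ι_desc_assoc, Sigma.ι_map_assoc, Sigma.ι_desc, h g.1 g.2])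

lemma inl_desc {k : SimplexCategory} {Z : C} (a : E.obj k ⟶ Z)
    (c : ∀ g : n ⟶ k, Mono g → (d.V ⟶ Z)) (h : ∀ g hg, d.e ≫ c g hg = E.map g ≫ a) :
    d.inl k ≫ d.desc a c h = a :=
  pushout.inl_desc _ _ _

lemma cell_desc {k : SimplexCategory} {Z : C} (a : E.obj k ⟶ Z)
    (c : ∀ g : n ⟶ k, Mono g → (d.V ⟶ Z)) (h : ∀ g hg, d.e ≫ c g hg = E.map g ≫ a)
    (g : n ⟶ k) (hg : Mono g) : d.cell g hg ≫ d.desc a c h = c g hg := by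
  refine (Category.assoc _ _ _).trans ((congrArg (Sigma.ι _ _ ≫ ·)
    (pushout.inr_desc _ _ _)).trans (Sigma.ι_desc _ _))

variable {d} in
lemma hom_ext {k : SimplexCategory} {Z : C} {x y : d.level k ⟶ Z}
    (h : d.inl k ≫ x = d.inl k ≫ y) (h' : ∀ g hg, d.cell g hg ≫ x = d.cell g hg ≫ y) : x = y := by
  refine pushout.hom_ext h (Sigma.hom_ext _ _ fun g => ?_)
  exact (Category.assoc _ _ _).symm.trans ((h' g.1 g.2).trans (Category.assoc _ _ _))

open Classical in
/-- The map `V ⟶ E'^k` given by an arbitrary map `[n] ⟶ [k]`. -/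
def out {k : SimplexCategory} (g : n ⟶ k) : d.V ⟶ d.level k :=
  if hg : Mono g then d.cell g hg else d.m g hg ≫ d.inl k

lemma out_of_mono {k : SimplexCategory} (g : n ⟶ k) (hg : Mono g) : d.out g = d.cell g hg :=
  dif_pos hg

lemma out_of_not_mono {k : SimplexCategory} (g : n ⟶ k) (hg : ¬ Mono g) :
    d.out g = d.m g hg ≫ d.inl k :=
  dif_neg hg

lemma e_out {k : SimplexCategory} (g : n ⟶ k) : d.e ≫ d.out g = E.map g ≫ d.inl k := by
  by_cases hg : Mono g
  · rw [d.out_of_mono g hg, e_cell]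
  · rw [d.out_of_not_mono g hg, ← Category.assoc, e_m]

/-- The structure maps of the cosimplicial object obtained by attaching cells. -/
def levelMap {k l : SimplexCategory} (θ : k ⟶ l) : d.level k ⟶ d.level l :=
  d.desc (E.map θ ≫ d.inl l) (fun g _ => d.out (g ≫ θ)) (fun g _ => by
    rw [e_out, Functor.map_comp_assoc])

lemma inl_levelMap {k l : SimplexCategory} (θ : k ⟶ l) :
    d.inl k ≫ d.levelMap θ = E.map θ ≫ d.inl l :=
  d.inl_desc _ _ _

lemma out_levelMap {k l : SimplexCategory} (g : n ⟶ k) (θ : k ⟶ l) :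
    d.out g ≫ d.levelMap θ = d.out (g ≫ θ) := by
  by_cases hg : Mono g
  · rw [d.out_of_mono g hg]
    exact d.cell_desc _ _ _ _ _
  · have hg' : ¬ Mono (g ≫ θ) := fun _ => hg (mono_of_mono g θ)
    rw [d.out_of_not_mono g hg, d.out_of_not_mono _ hg', Category.assoc, inl_levelMap,
      ← d.m_map g θ hg hg', Category.assoc]

variable {d} in
lemma hom_ext' {k : SimplexCategory} {Z : C} {x y : d.level k ⟶ Z}
    (h : d.inl k ≫ x = d.inl k ≫ y) (h' : ∀ g, Mono g → d.out g ≫ x = d.out g ≫ y) : x = y :=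
  hom_ext h fun g hg => by
    rw [← d.out_of_mono g hg]
    exact h' g hg

/-- The cosimplicial object obtained by attaching cells. -/
def attach : SimplexCategory ⥤ C where
  obj := d.level
  map := d.levelMap
  map_id k := hom_ext' (by simp [inl_levelMap]) fun g _ => by simp [out_levelMap]
  map_comp θ θ' := hom_ext' (by simp [inl_levelMap, reassoc_of% inl_levelMap])
    fun g _ => by simp [out_levelMap, reassoc_of% out_levelMap]

/-- The inclusion of `E` in the cosimplicial object obtained by attaching cells. -/
def incl : E ⟶ d.attach where
  app := d.inl
  naturality _ _ θ := (d.inl_levelMap θ).symm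

/-- The map from a cell to the cosimplicial object obtained by attaching cells. -/
def cellMap {k : SimplexCategory} (g : n ⟶ k) : d.V ⟶ d.attach.obj k := d.out g

lemma e_cellMap {k : SimplexCategory} (g : n ⟶ k) :
    d.e ≫ d.cellMap g = E.map g ≫ d.incl.app k :=
  d.e_out g

lemma cellMap_map {k l : SimplexCategory} (g : n ⟶ k) (θ : k ⟶ l) :
    d.cellMap g ≫ d.attach.map θ = d.cellMap (g ≫ θ) :=
  d.out_levelMap g θ

lemma cellMap_of_not_mono {k : SimplexCategory} (g : n ⟶ k) (hg : ¬ Mono g) :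
    d.cellMap g = d.m g hg ≫ d.incl.app k :=
  d.out_of_not_mono g hg

variable {d} in
lemma attach_hom_ext {k : SimplexCategory} {Z : C} {x y : d.attach.obj k ⟶ Z}
    (h : d.incl.app k ≫ x = d.incl.app k ≫ y)
    (h' : ∀ g, Mono g → d.cellMap g ≫ x = d.cellMap g ≫ y) : x = y :=
  hom_ext' h h'

/-- A map out of a level is given by a map on `E` and on all cells. -/
def attachDesc {k : SimplexCategory} {Z : C} (a : E.obj k ⟶ Z)
    (c : ∀ g : n ⟶ k, Mono g → (d.V ⟶ Z)) (h : ∀ g hg, d.e ≫ c g hg = E.map g ≫ a) :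
    d.attach.obj k ⟶ Z :=
  d.desc a c h

lemma incl_attachDesc {k : SimplexCategory} {Z : C} (a : E.obj k ⟶ Z)
    (c : ∀ g : n ⟶ k, Mono g → (d.V ⟶ Z)) (h : ∀ g hg, d.e ≫ c g hg = E.map g ≫ a) :
    d.incl.app k ≫ d.attachDesc a c h = a :=
  pushout.inl_desc _ _ _

lemma cellMap_attachDesc {k : SimplexCategory} {Z : C} (a : E.obj k ⟶ Z)
    (c : ∀ g : n ⟶ k, Mono g → (d.V ⟶ Z)) (h : ∀ g hg, d.e ≫ c g hg = E.map g ≫ a)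
    (g : n ⟶ k) (hg : Mono g) : d.cellMap g ≫ d.attachDesc a c h = c g hg :=
  (congrArg (· ≫ d.desc a c h) (d.out_of_mono g hg)).trans (d.cell_desc a c h g hg)

/-- There is no injection `[n] ⟶ [k]` for `k < n`, hence no cell is attached in level `k`. -/
lemma isIso_incl_app {k : SimplexCategory} (hk : k.len < n.len) : IsIso (d.incl.app k) := by
  have hm (g : n ⟶ k) : ¬ Mono g := fun _ => by
    have := SimplexCategory.len_le_of_mono g
    omega
  refine ⟨d.attachDesc (𝟙 _) (fun g hg => absurd hg (hm g)) (fun g hg => absurd hg (hm g)),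
    d.incl_attachDesc _ _ _, ?_⟩
  refine attach_hom_ext ?_ fun g hg => absurd hg (hm g)
  rw [reassoc_of% d.incl_attachDesc, Category.comp_id, Category.id_comp]

lemma isIso_cellMap_id : IsIso (d.cellMap (𝟙 n)) := by
  refine ⟨d.attachDesc d.e (fun _ _ => 𝟙 _) (fun g hg => ?_), ?_, ?_⟩
  · rw [SimplexCategory.eq_id_of_mono g]
    simp
  · exact d.cellMap_attachDesc _ _ _ _ inferInstance
  · refine attach_hom_ext ?_ fun g hg => ?_
    · rw [reassoc_of% incl_attachDesc, e_cellMap]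
      simp
    · rw [reassoc_of% (cellMap_attachDesc _ _ _ _ _ hg), SimplexCategory.eq_id_of_mono g]
      simp

/-- Cells along proper faces have prescribed values. A lift against `p` is needed only for a cell
along an isomorphism, and there the lifting property of `d.e` provides it. -/
lemma latchLift_incl {Z Z' : C} (p : Z ⟶ Z') [HasLiftingProperty d.e p] (N : SimplexCategory) :
    LatchLift d.incl p N := by
  intro a b y hab hy hya hyb
  have key (g : n ⟶ N) (hg : Mono g) : ∃ v : d.V ⟶ Z, v ≫ p = d.cellMap g ≫ b ∧
      d.e ≫ v = E.map g ≫ a ∧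
      ∀ hg' : ¬ IsIso g, v = d.cellMap (𝟙 n) ≫ y (.mk g hg hg') := by
    by_cases hg' : IsIso g
    · have sq : CommSq (E.map g ≫ a) d.e p (d.cellMap g ≫ b) :=
        ⟨by rw [Category.assoc, hab, reassoc_of% e_cellMap]⟩
      exact ⟨sq.lift, sq.fac_right, sq.fac_left, fun h => absurd hg' h⟩
    · refine ⟨d.cellMap (𝟙 n) ≫ y (.mk g hg hg'), ?_, ?_, fun _ => rfl⟩
      · rw [Category.assoc, hyb, reassoc_of% cellMap_map]
        exact congrArg (fun t => d.cellMap t ≫ b) (Category.id_comp _)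
      · rw [reassoc_of% e_cellMap, E.map_id, Category.id_comp]
        exact hya (.mk g hg hg')
  choose v hv hv' hv'' using key
  refine ⟨d.attachDesc a v hv', d.incl_attachDesc _ _ _, ?_, fun f => ?_⟩
  · refine attach_hom_ext ?_ fun g hg => ?_
    · rw [reassoc_of% incl_attachDesc, hab]
    · rw [reassoc_of% (cellMap_attachDesc _ _ _ _ _ hg), hv]
  · refine attach_hom_ext ?_ fun κ hκ => ?_
    · rw [← NatTrans.naturality_assoc, incl_attachDesc, hya]
    · have := f.property.1
      have hm : Mono (κ ≫ f.obj.hom) := mono_comp _ _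
      have hiso : ¬ IsIso (κ ≫ f.obj.hom) := fun h => by
        have h1 := SimplexCategory.len_le_of_epi (κ ≫ f.obj.hom)
        have h2 := SimplexCategory.len_le_of_mono κ
        have h3 := f.len_lt
        omega
      rw [reassoc_of% cellMap_map, cellMap_attachDesc _ _ _ _ _ hm, hv'' _ _ hiso,
        ← hy (f := .mk (κ ≫ f.obj.hom) hm hiso) (g := f) (LatchingIndex.homMk κ rfl),
        reassoc_of% cellMap_map]
      exact congrArg (fun t => d.cellMap t ≫ y f) (Category.id_comp _)

end AttachingData

end Attaching

/-! ### Matching objects and levelwise factorizations -/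

/-- The index category of the `n`-th matching object: surjections `[n] ⟶ [k]` in the simplex
category that are not isomorphisms, with the morphisms under `[n]`. -/
abbrev MatchingIndex (n : SimplexCategory) : Type :=
  ObjectProperty.FullSubcategory (fun f : Under n => Epi f.hom ∧ ¬ IsIso f.hom)

instance (n : SimplexCategory) : Finite (MatchingIndex n) := by
  let F : MatchingIndex n → Σ k : Fin (n.len + 1), (n ⟶ ⦋(k : ℕ)⦌) := fun f =>
    have hf : Epi f.obj.hom := f.property.1
    ⟨⟨f.obj.right.len, Nat.lt_succ_of_le (SimplexCategory.len_le_of_epi f.obj.hom)⟩, f.obj.hom⟩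
  refine Finite.of_injective F ?_
  rintro ⟨⟨⟨⟨⟩⟩, k, f⟩, hf⟩ ⟨⟨⟨⟨⟩⟩, l, g⟩, hg⟩ h
  have hlen : k.len = l.len := congrArg (fun x => (x.1 : ℕ)) h
  obtain rfl : k = l := by ext; exact hlen
  obtain rfl : f = g := by simpa [F] using h
  rfl

instance (n : SimplexCategory) (a b : MatchingIndex n) : Finite (a ⟶ b) :=
  Finite.of_injective (fun f : a ⟶ b => f.hom.right) (by
    intro f g h
    ext1
    exact Under.UnderMorphism.ext h)

instance (n : SimplexCategory) : FinCategory (MatchingIndex n) where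
  fintypeObj := Fintype.ofFinite _
  fintypeHom _ _ := Fintype.ofFinite _

namespace MatchingIndex

/-- The object of the matching category given by a noninvertible epimorphism. -/
abbrev mk {n k : SimplexCategory} (f : n ⟶ k) (hf : Epi f) (hf' : ¬ IsIso f) :
    MatchingIndex n := ⟨Under.mk f, hf, hf'⟩

/-- A morphism in the matching category. -/
abbrev homMk {n : SimplexCategory} {f g : MatchingIndex n}
    (θ : f.obj.right ⟶ g.obj.right) (h : f.obj.hom ≫ θ = g.obj.hom) : f ⟶ g :=
  ObjectProperty.homMk (Under.homMk θ h)

lemma len_lt {n : SimplexCategory} (f : MatchingIndex n) : f.obj.right.len < n.len := by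
  have : Epi f.obj.hom := f.property.1
  refine (SimplexCategory.len_le_of_epi f.obj.hom).lt_of_ne fun h => f.property.2 ?_
  obtain ⟨⟨⟨⟨⟩⟩, k, f⟩, hf⟩ := f
  obtain rfl : k = n := by ext; exact h
  have : f = 𝟙 k := SimplexCategory.eq_id_of_epi (f : k ⟶ k)
  change IsIso f
  rw [this]; exact inferInstanceAs (IsIso (𝟙 k))

lemma epi_right {n : SimplexCategory} {f g : MatchingIndex n} (θ : f ⟶ g) : Epi θ.hom.right := by
  have : Epi g.obj.hom := g.property.1
  have : Epi (f.obj.hom ≫ θ.hom.right) := by rw [Under.w]; infer_instance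
  exact epi_of_epi f.obj.hom θ.hom.right

lemma len_lt_or_eq {n : SimplexCategory} {f g : MatchingIndex n} (θ : f ⟶ g) :
    g.obj.right.len < f.obj.right.len ∨ ∃ h : f = g, θ = eqToHom h := by
  have := epi_right θ
  obtain hlt | heq := (SimplexCategory.len_le_of_epi θ.hom.right).lt_or_eq
  · exact Or.inl hlt
  · right
    obtain ⟨⟨⟨⟨⟩⟩, k, f⟩, hf⟩ := f
    obtain ⟨⟨⟨⟨⟩⟩, l, g⟩, hg⟩ := g
    obtain rfl : k = l := by ext; exact heq.symm
    have hθ : θ.hom.right = 𝟙 k := SimplexCategory.eq_id_of_epi _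
    have hw := Under.w θ.hom
    rw [hθ] at hw
    have hfg : f = g := (Category.comp_id _).symm.trans hw
    subst hfg
    refine ⟨rfl, ?_⟩
    ext1
    exact Under.UnderMorphism.ext hθ

/-- Composition of a proper degeneracy with a degeneracy. -/
abbrev comp {n : SimplexCategory} (f : MatchingIndex n)
    (κ : MatchingIndex f.obj.right) : MatchingIndex n :=
  .mk (f.obj.hom ≫ κ.obj.hom)
    (by have := f.property.1; have := κ.property.1; exact epi_comp _ _)
    (fun h => by
      have : Epi f.obj.hom := f.property.1
      have := κ.property.1
      have h2 := SimplexCategory.len_le_of_mono (f.obj.hom ≫ κ.obj.hom)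
      have h1 := κ.len_lt
      have h3 := f.len_lt
      omega)

end MatchingIndex

section

variable {C : Type u} [Category.{v} C]

/-- Extensions along `i` of maps into `E^n` with prescribed values in the matching object. -/
def MatchLift (E : SimplexCategory ⥤ C) {U U' : C} (i : U ⟶ U') (n : SimplexCategory) : Prop :=
  ∀ (x : U ⟶ E.obj n) (y : ∀ f : MatchingIndex n, U' ⟶ E.obj f.obj.right),
    (∀ {f g : MatchingIndex n} (θ : f ⟶ g), y f ≫ E.map θ.hom.right = y g) →
    (∀ f, i ≫ y f = x ≫ E.map f.obj.hom) →
    ∃ h : U' ⟶ E.obj n, i ≫ h = x ∧ ∀ f, h ≫ E.map f.obj.hom = y f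

/-- Dual to the latching argument: the components in the proper quotients of `[n]` are built by
increasing dimension, then lifted to level `n`. -/
lemma exists_extension_of_matchLift (E : SimplexCategory ⥤ C) {U U' : C} (i : U ⟶ U')
    (n : SimplexCategory) (H : ∀ k : SimplexCategory, k.len ≤ n.len → MatchLift E i k)
    (x : U ⟶ E.obj n) : ∃ h : U' ⟶ E.obj n, i ≫ h = x := by
  obtain ⟨y, hy, hy'⟩ := exists_section (fun f g : MatchingIndex n => g ⟶ f)
    (fun f => U' ⟶ E.obj f.obj.right) (fun {f g} θ z => z ≫ E.map θ.hom.right)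
    (fun f => f.obj.right.len)
    (fun {f g} θ => by
      obtain h | ⟨rfl, rfl⟩ := MatchingIndex.len_lt_or_eq θ
      · exact Or.inl h
      · exact Or.inr ⟨rfl, fun x => by simp⟩)
    (fun f z => i ≫ z = x ≫ E.map f.obj.hom)
    (fun f y hy hy' => by
      obtain ⟨z, h1, h2⟩ := H _ f.len_lt.le (x ≫ E.map f.obj.hom)
        (fun κ => y (f.comp κ) κ.len_lt)
        (fun {κ κ'} θ => hy' (f.comp κ') (f.comp κ)
          (MatchingIndex.homMk θ.hom.right (by simp)) _ _)
        (fun κ => (hy (f.comp κ) κ.len_lt).trans (by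
          rw [Category.assoc, ← E.map_comp]
          rfl))
      refine ⟨z, h1, fun g θ hg => ?_⟩
      have hθ := MatchingIndex.epi_right θ
      let κ : MatchingIndex f.obj.right := .mk θ.hom.right hθ (fun h => by
        have := SimplexCategory.len_le_of_mono θ.hom.right
        omega)
      rw [← hy' g (f.comp κ) (MatchingIndex.homMk (𝟙 _) (by simp [κ])) hg κ.len_lt]
      exact (h2 κ).trans ((congrArg (y (f.comp κ) _ ≫ ·) (E.map_id _)).trans
        (Category.comp_id _)).symm)
    n.len (fun f => f.len_lt)
  obtain ⟨h, hx, -⟩ := H n le_rfl x y (fun θ => hy' _ _ θ) hy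
  exact ⟨h, hx⟩

lemma MatchLift.of_isIso {E E' : SimplexCategory ⥤ C} (φ : E ⟶ E') {U U' : C} {i : U ⟶ U'}
    {n : SimplexCategory} (hφ : ∀ k : SimplexCategory, k.len ≤ n.len → IsIso (φ.app k))
    (H : MatchLift E i n) : MatchLift E' i n := by
  intro x y hy hyx
  have := hφ n le_rfl
  have (f : MatchingIndex n) := hφ _ f.len_lt.le
  obtain ⟨h, h1, h2⟩ := H (x ≫ inv (φ.app n)) (fun f => y f ≫ inv (φ.app _))
    (fun {f g} θ => by
      rw [← cancel_mono (φ.app _), Category.assoc, Category.assoc, φ.naturality,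
        IsIso.inv_hom_id_assoc, hy, Category.assoc, IsIso.inv_hom_id, Category.comp_id])
    (fun f => by
      rw [← cancel_mono (φ.app _), Category.assoc, Category.assoc, Category.assoc, Category.assoc,
        φ.naturality, IsIso.inv_hom_id_assoc, IsIso.inv_hom_id, Category.comp_id, hyx])
  refine ⟨h ≫ φ.app n, by rw [reassoc_of% h1, IsIso.inv_hom_id, Category.comp_id], fun f => ?_⟩
  rw [Category.assoc, ← φ.naturality, reassoc_of% (h2 f), IsIso.inv_hom_id, Category.comp_id]

variable [HasFiniteLimits C]

/-- The matching object `M_n E`. -/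
def matchingObj (E : SimplexCategory ⥤ C) (n : SimplexCategory) : C :=
  limit (ObjectProperty.ι _ ⋙ Under.forget n ⋙ E : MatchingIndex n ⥤ C)

/-- The projections of the matching object. -/
def matchingπ (E : SimplexCategory ⥤ C) {n : SimplexCategory} (f : MatchingIndex n) :
    matchingObj E n ⟶ E.obj f.obj.right :=
  limit.π (ObjectProperty.ι _ ⋙ Under.forget n ⋙ E : MatchingIndex n ⥤ C) f

lemma matchingπ_map (E : SimplexCategory ⥤ C) {n : SimplexCategory} {f g : MatchingIndex n}
    (θ : f ⟶ g) : matchingπ E f ≫ E.map θ.hom.right = matchingπ E g :=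
  limit.w (ObjectProperty.ι _ ⋙ Under.forget n ⋙ E : MatchingIndex n ⥤ C) θ

lemma matching_hom_ext {E : SimplexCategory ⥤ C} {n : SimplexCategory} {Z : C}
    {x y : Z ⟶ matchingObj E n} (h : ∀ f, x ≫ matchingπ E f = y ≫ matchingπ E f) : x = y :=
  limit.hom_ext h

/-- The map to the matching object given by a compatible family. -/
def matchingLift {E : SimplexCategory ⥤ C} {n : SimplexCategory} {Z : C}
    (y : ∀ f : MatchingIndex n, Z ⟶ E.obj f.obj.right)
    (hy : ∀ (f g : MatchingIndex n) (θ : f ⟶ g), y f ≫ E.map θ.hom.right = y g) :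
    Z ⟶ matchingObj E n :=
  limit.lift _
    { pt := Z
      π := { app := y
             naturality := fun _ _ θ => (Category.id_comp _).trans (hy _ _ θ).symm } }

lemma matchingLift_matchingπ {E : SimplexCategory ⥤ C} {n : SimplexCategory} {Z : C}
    (y : ∀ f : MatchingIndex n, Z ⟶ E.obj f.obj.right)
    (hy : ∀ (f g : MatchingIndex n) (θ : f ⟶ g), y f ≫ E.map θ.hom.right = y g)
    (f : MatchingIndex n) : matchingLift y hy ≫ matchingπ E f = y f :=
  limit.lift_π _ _

/-- The matching map `E^n ⟶ M_n E`. -/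
def matchingMap (E : SimplexCategory ⥤ C) (n : SimplexCategory) : E.obj n ⟶ matchingObj E n :=
  matchingLift (fun f => E.map f.obj.hom) (fun _ _ θ => by rw [← E.map_comp, Under.w])

/-- A section of the surjection `f` induces a morphism `f ⟶ f'`, as `ι'` is mono. Hence the value
assigned to a noninjective map does not depend on its factorisation, which yields `m_map` below. -/
lemma matchingπ_map_congr (E : SimplexCategory ⥤ C) {n k : SimplexCategory}
    {f f' : MatchingIndex n} (ι : f.obj.right ⟶ k) (ι' : f'.obj.right ⟶ k) [Mono ι']
    (h : f.obj.hom ≫ ι = f'.obj.hom ≫ ι') :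
    matchingπ E f ≫ E.map ι = matchingπ E f' ≫ E.map ι' := by
  have : Epi f.obj.hom := f.property.1
  have hs : IsSplitEpi f.obj.hom := isSplitEpi_of_epi _
  have h1 : f.obj.hom ≫ section_ f.obj.hom ≫ f'.obj.hom = f'.obj.hom := by
    rw [← cancel_mono ι', Category.assoc, Category.assoc, ← h, IsSplitEpi.id_assoc]
  have h2 : (section_ f.obj.hom ≫ f'.obj.hom) ≫ ι' = ι := by
    rw [Category.assoc, ← h, IsSplitEpi.id_assoc]
  rw [← matchingπ_map E (MatchingIndex.homMk (section_ f.obj.hom ≫ f'.obj.hom) h1 : f ⟶ f'),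
    Category.assoc, ← E.map_comp]
  exact congrArg (fun t => matchingπ E f ≫ E.map t) h2.symm

/-- The index of the surjective part of a noninjective map. -/
abbrev MatchingIndex.image {n k : SimplexCategory} (g : n ⟶ k) (hg : ¬ Mono g) :
    MatchingIndex n :=
  .mk (factorThruImage g) inferInstance (fun h => hg (by
    rw [← image.fac g]
    exact mono_comp _ _))

/-- A factorisation of the matching map through `V` gives attaching data. -/
def AttachingData.ofFactorization (E : SimplexCategory ⥤ C) (n : SimplexCategory) {V : C}
    (e : E.obj n ⟶ V) (q : V ⟶ matchingObj E n) (h : e ≫ q = matchingMap E n) :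
    AttachingData E n where
  V := V
  e := e
  m g hg := q ≫ matchingπ E (.image g hg) ≫ E.map (image.ι g)
  m_map g θ hg hg' := by
    rw [Category.assoc, Category.assoc, ← E.map_comp]
    congr 1
    refine matchingπ_map_congr E (f := .image g hg) (f' := .image (g ≫ θ) hg') _ _ ?_
    change factorThruImage g ≫ image.ι g ≫ θ = factorThruImage (g ≫ θ) ≫ image.ι (g ≫ θ)
    rw [image.fac, image.fac_assoc]
  e_m g hg := by
    rw [reassoc_of% h, matchingMap, reassoc_of% matchingLift_matchingπ]
    change E.map (factorThruImage g) ≫ _ = _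
    rw [← E.map_comp, image.fac]

lemma AttachingData.ofFactorization_m (E : SimplexCategory ⥤ C) (n : SimplexCategory) {V : C}
    (e : E.obj n ⟶ V) (q : V ⟶ matchingObj E n) (h : e ≫ q = matchingMap E n)
    (f : MatchingIndex n) (hf : ¬ Mono f.obj.hom) :
    (ofFactorization E n e q h).m f.obj.hom hf = q ≫ matchingπ E f := by
  change q ≫ matchingπ E (.image f.obj.hom hf) ≫ E.map (image.ι f.obj.hom) = _
  rw [← matchingπ_map_congr E (f := f) (f' := .image f.obj.hom hf) (𝟙 _) (image.ι _)
    ((Category.comp_id _).trans (image.fac _).symm)]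
  simp

/-- Level `n` of `d.attach` is `d.V` and the lower levels are those of `E`; under these isomorphisms
the `n`-th matching map is `q`. -/
lemma AttachingData.matchLift_attach [HasFiniteColimits C] {E : SimplexCategory ⥤ C}
    {n : SimplexCategory} (d : AttachingData E n) (q : d.V ⟶ matchingObj E n)
    (hq : ∀ (f : MatchingIndex n) (hf : ¬ Mono f.obj.hom),
      d.m f.obj.hom hf = q ≫ matchingπ E f)
    {U U' : C} (i : U ⟶ U') [HasLiftingProperty i q] : MatchLift d.attach i n := by
  intro x y hy hyx
  have := d.isIso_cellMap_id
  have (f : MatchingIndex n) := d.isIso_incl_app f.len_lt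
  have hm (f : MatchingIndex n) : ¬ Mono f.obj.hom := fun _ => by
    have := SimplexCategory.len_le_of_mono f.obj.hom
    have := f.len_lt
    omega
  have hcell (f : MatchingIndex n) : d.cellMap (𝟙 n) ≫ d.attach.map f.obj.hom =
      q ≫ matchingπ E f ≫ d.incl.app _ := by
    rw [d.cellMap_map]
    refine (congrArg d.cellMap (Category.id_comp _)).trans ?_
    refine (d.cellMap_of_not_mono f.obj.hom (hm f)).trans ?_
    rw [hq, Category.assoc]
  let z : U' ⟶ matchingObj E n := matchingLift (fun f => y f ≫ inv (d.incl.app _))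
    (fun f g θ => by
      rw [← cancel_mono (d.incl.app _), Category.assoc, Category.assoc, d.incl.naturality,
        IsIso.inv_hom_id_assoc, hy, Category.assoc, IsIso.inv_hom_id, Category.comp_id])
  have sq : CommSq (x ≫ inv (d.cellMap (𝟙 n))) i q z := ⟨by
    refine matching_hom_ext fun f => ?_
    rw [Category.assoc, Category.assoc, Category.assoc, matchingLift_matchingπ,
      ← cancel_mono (d.incl.app _),
      Category.assoc, Category.assoc, Category.assoc, Category.assoc, Category.assoc, ← hcell,
      IsIso.inv_hom_id_assoc, IsIso.inv_hom_id, Category.comp_id, hyx]⟩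
  refine ⟨sq.lift ≫ d.cellMap (𝟙 n), ?_, fun f => ?_⟩
  · rw [sq.fac_left_assoc, Category.assoc, IsIso.inv_hom_id, Category.comp_id]
  · rw [Category.assoc, hcell, sq.fac_right_assoc, reassoc_of% matchingLift_matchingπ,
      Category.assoc, IsIso.inv_hom_id, Category.comp_id]

end

/-! ### Reedy factorizations -/

section

variable {C : Type u} [Category.{v} C] [ModelCategory C]

/-- One step in the construction of Reedy factorisations: a Reedy cofibration which is an
isomorphism below level `n` and whose target has a trivial fibration as `n`-th matching map. -/
lemma exists_attach (E : SimplexCategory ⥤ C) (n : SimplexCategory) :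
    ∃ (E' : SimplexCategory ⥤ C) (j : E ⟶ E'), IsReedyCofibration j ∧
      (∀ k : SimplexCategory, k.len < n.len → IsIso (j.app k)) ∧
      ∀ {U U' : C} (i : U ⟶ U'), Cofibration i → MatchLift E' i n := by
  -- The cofibration makes the inclusion a Reedy cofibration; the trivial fibration becomes the new
  -- matching map.
  have h := MorphismProperty.factorizationData (cofibrations C) (trivialFibrations C)
    (matchingMap E n)
  let d := AttachingData.ofFactorization E n h.i h.p h.fac
  refine ⟨d.attach, d.incl, ?_, fun k hk => d.isIso_incl_app hk, fun i hi => ?_⟩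
  · rw [isReedyCofibration_iff]
    intro Z Z' p _ _ k
    have : HasLiftingProperty d.e p := inferInstanceAs (HasLiftingProperty h.i p)
    exact d.latchLift_incl p k
  · let q : d.V ⟶ matchingObj E n := h.p
    have : HasLiftingProperty i q := ModelCategory.cm4b i h.p
    exact d.matchLift_attach q (AttachingData.ofFactorization_m E n h.i h.p h.fac) i

/-- The tower of cosimplicial objects in the construction of Reedy factorisations. -/
def tower (T : SimplexCategory ⥤ C) (n : ℕ) : SimplexCategory ⥤ C :=
  n.rec T fun n E => (exists_attach E ⦋n⦌).choose

/-- The maps in the tower. -/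
def towerMap (T : SimplexCategory ⥤ C) (n : ℕ) : tower T n ⟶ tower T (n + 1) :=
  (exists_attach (tower T n) ⦋n⦌).choose_spec.choose

lemma towerMap_spec (T : SimplexCategory ⥤ C) (n : ℕ) :
    IsReedyCofibration (towerMap T n) ∧
      (∀ k : SimplexCategory, k.len < n → IsIso ((towerMap T n).app k)) ∧
      ∀ {U U' : C} (i : U ⟶ U'), Cofibration i → MatchLift (tower T (n + 1)) i ⦋n⦌ :=
  (exists_attach (tower T n) ⦋n⦌).choose_spec.choose_spec

/-- The tower as a functor. -/
def towerFunctor (T : SimplexCategory ⥤ C) : ℕ ⥤ SimplexCategory ⥤ C :=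
  Functor.ofSequence (towerMap T)

lemma towerFunctor_map_succ (T : SimplexCategory ⥤ C) (n : ℕ) :
    (towerFunctor T).map (homOfLE (Nat.le_add_right n 1)) = towerMap T n :=
  Functor.ofSequence_map_homOfLE_succ _ _

lemma towerFunctor_map_zero (T : SimplexCategory ⥤ C) (n : ℕ) :
    IsReedyCofibration ((towerFunctor T).map (homOfLE (Nat.zero_le n))) := by
  induction n with
  | zero =>
    rw [isReedyCofibration_iff]
    intro Z Z' p _ _ k
    refine latchLift_of_isIso _ _ _ fun l _ => ?_
    have : (homOfLE (Nat.zero_le 0)) = 𝟙 0 := rfl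
    rw [this, CategoryTheory.Functor.map_id]
    exact inferInstanceAs (IsIso (𝟙 ((tower T 0).obj l)))
  | succ n ih =>
    have h : homOfLE (Nat.zero_le (n + 1)) =
      homOfLE (Nat.zero_le n) ≫ homOfLE (Nat.le_add_right n 1) := rfl
    rw [h, Functor.map_comp, towerFunctor_map_succ]
    exact ih.comp (towerMap_spec T n).1

/-- Step `n` of the tower changes only levels of dimension at least `n`, so level `k` is stable from
stage `k.len + 1` on. In particular the sequential colimit exists although only finite colimits are
available. -/
lemma towerFunctor_isEventuallyConstantFrom (T : SimplexCategory ⥤ C) (k : SimplexCategory) :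
    ((towerFunctor T).flip.obj k).IsEventuallyConstantFrom (k.len + 1) := by
  intro j f
  obtain ⟨j, rfl⟩ := Nat.exists_eq_add_of_le (leOfHom f)
  obtain rfl : f = homOfLE (Nat.le_add_right _ j) := rfl
  induction j with
  | zero => exact inferInstanceAs (IsIso (((towerFunctor T).flip.obj k).map (𝟙 _)))
  | succ j ih =>
    have h : homOfLE (Nat.le_add_right (k.len + 1) (j + 1)) =
      homOfLE (Nat.le_add_right (k.len + 1) j) ≫
        homOfLE (Nat.le_add_right (k.len + 1 + j) 1) := rfl
    rw [h, Functor.map_comp]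
    have : IsIso (((towerFunctor T).flip.obj k).map
        (homOfLE (Nat.le_add_right (k.len + 1 + j) 1))) := by
      rw [Functor.flip_obj_map, towerFunctor_map_succ]
      exact (towerMap_spec T (k.len + 1 + j)).2.1 k (by omega)
    infer_instance

instance (T : SimplexCategory ⥤ C) (k : SimplexCategory) :
    HasColimit ((towerFunctor T).flip.obj k) :=
  (towerFunctor_isEventuallyConstantFrom T k).hasColimit

lemma isIso_colimit_ι_towerFunctor (T : SimplexCategory ⥤ C) (n : ℕ) (k : SimplexCategory)
    (hk : k.len < n) : IsIso ((colimit.ι (towerFunctor T) n).app k) :=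
  (towerFunctor_isEventuallyConstantFrom T k).isIso_ι_of_isColimit'
    (isColimitOfPreserves ((evaluation _ _).obj k) (colimit.isColimit (towerFunctor T))) n
    (homOfLE hk)

/-- Every cosimplicial object admits a Reedy cofibration to a levelwise weakly contractible
cosimplicial object. -/
theorem exists_isReedyCofibration_terminal (T : SimplexCategory ⥤ C) :
    ∃ (E : SimplexCategory ⥤ C) (j : T ⟶ E), IsReedyCofibration j ∧
      ∀ n, WeakEquivalence (terminal.from (E.obj n)) := by
  refine ⟨colimit (towerFunctor T), colimit.ι (towerFunctor T) 0, ?_, fun n => ?_⟩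
  · change IsReedyCofibration (A := (towerFunctor T).obj 0) (colimit.ι (towerFunctor T) 0)
    rw [isReedyCofibration_iff]
    intro Z Z' p h h' n
    -- Up to degree `n`, the map to the colimit is a finite composite of Reedy cofibrations followed
    -- by isomorphisms.
    rw [← colimit.w (towerFunctor T) (homOfLE (Nat.zero_le (n.len + 1)))]
    refine LatchLift.comp ((isReedyCofibration_iff _).1 (towerFunctor_map_zero T _) p h h' n) ?_
    exact latchLift_of_isIso _ _ _ fun k hk =>
      isIso_colimit_ι_towerFunctor T _ k (Nat.lt_succ_of_le hk)
  · refine (trivialFibration_of_hasLiftingProperty _ fun {U U'} i hi => ⟨fun {x y} sq => ?_⟩).2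
    obtain ⟨h, hx⟩ := exists_extension_of_matchLift (colimit (towerFunctor T)) i n
      (fun k _ => MatchLift.of_isIso (colimit.ι (towerFunctor T) (k.len + 1))
        (fun l hl => isIso_colimit_ι_towerFunctor T _ l (Nat.lt_succ_of_le hl))
        ((towerMap_spec T k.len).2.2 i hi)) x
    exact ⟨⟨h, hx, terminalIsTerminal.hom_ext _ _⟩⟩

/-- Every map to a constant cosimplicial object factors as a Reedy cofibration followed by a
levelwise weak equivalence. -/
theorem exists_reedy_factorization {T : SimplexCategory ⥤ C} {W : C} (f : T ⟶ constObj W) :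
    ∃ (E : SimplexCategory ⥤ C) (j : T ⟶ E) (p : E ⟶ constObj W), j ≫ p = f ∧
      IsReedyCofibration j ∧ ∀ n, WeakEquivalence (p.app n) := by
  let T' : SimplexCategory ⥤ Over W :=
    { obj n := Over.mk (f.app n)
      map θ := Over.homMk (T.map θ) ((f.naturality θ).trans (Category.comp_id _))
      map_id _ := Over.OverMorphism.ext (T.map_id _)
      map_comp _ _ := Over.OverMorphism.ext (T.map_comp _ _) }
  obtain ⟨E, j, hj, hE⟩ := exists_isReedyCofibration_terminal T'
  refine ⟨E ⋙ Over.forget W,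
    { app n := (j.app n).left
      naturality _ _ θ := congrArg CommaMorphism.left (j.naturality θ) },
    { app n := (E.obj n).hom
      naturality _ _ θ := (Over.w (E.map θ)).trans (Category.comp_id _).symm }, ?_, ?_, fun n => ?_⟩
  · ext n
    exact Over.w (j.app n)
  · rw [isReedyCofibration_iff] at hj ⊢
    intro Z Z' p _ _ n
    refine latchLift_map_of_adjunction (Over.forgetAdjStar W) (φ := j) ?_
    -- The right adjoint `Over.star W` preserves trivial fibrations because the forgetful functor
    -- preserves cofibrations.
    have := trivialFibration_of_hasLiftingProperty ((Over.star W).map p) fun i hi => by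
      rw [← (Over.forgetAdjStar W).hasLiftingProperty_iff]
      have : Cofibration ((Over.forget W).map i) := (cofibrations_over_iff W i).1 hi
      infer_instance
    exact hj _ this.1 this.2 n
  · have := (weakEquivalences_over_iff W _).1 (hE n)
    rw [weakEquivalence_iff] at this ⊢
    let e : ⊤_ (Over W) ≅ Over.mk (𝟙 W) := terminalIsTerminal.uniqueUpToIso Over.mkIdTerminal
    let e' : (⊤_ (Over W)).left ≅ (constObj W).obj n := (Over.forget W).mapIso e
    have h : (terminal.from (E.obj n)).left ≫ e'.hom = (E.obj n).hom :=
      (Category.comp_id _).symm.trans (Over.w (terminal.from (E.obj n) ≫ e.hom))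
    change weakEquivalences C (E.obj n).hom
    rw [← h]
    exact MorphismProperty.RespectsIso.postcomp _ _ _ this

end

end CosimplicialFrames

/-! ### Weak homotopy equivalences of simplicial sets -/

open MonoidalCategory Opposite

namespace SSetHo

open SSet.modelCategoryQuillen

/-- A map of simplicial sets with the right lifting property with respect to boundary inclusions,
tested on compatible families of proper faces. -/
theorem rlp_I_of_latching {S S' : SSet.{v}} (q : S ⟶ S')
    (H : ∀ (N : SimplexCategory) (z : S'.obj (op N))
      (y : ∀ f : CosimplicialFrames.LatchingIndex N, S.obj (op f.obj.left)),
      (∀ {f g : CosimplicialFrames.LatchingIndex N} (θ : f ⟶ g),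
        S.map θ.hom.left.op (y g) = y f) →
      (∀ f, q.app _ (y f) = S'.map f.obj.hom.op z) →
      ∃ x : S.obj (op N), q.app _ x = z ∧ ∀ f, S.map f.obj.hom.op x = y f) :
    (I.{v}).rlp q := by
  rintro _ _ _ ⟨n⟩
  refine ⟨fun {t b} sq => ?_⟩
  have hmem {k : SimplexCategory} (f : k ⟶ ⦋n⦌) (hf : ¬ Epi f) :
      SSet.stdSimplex.objEquiv.symm f ∈ (SSet.boundary.{v} n).obj (op k) := fun h =>
    hf (SimplexCategory.epi_iff_surjective.2 h)
  have hepi (f : CosimplicialFrames.LatchingIndex ⦋n⦌) : ¬ Epi f.obj.hom := fun _ => by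
    have := SimplexCategory.len_le_of_epi f.obj.hom
    have := f.len_lt
    omega
  have hw {k : SimplexCategory} (f : k ⟶ ⦋n⦌) (hf : ¬ Epi f) :
      q.app _ (t.app _ ⟨_, hmem f hf⟩) = b.app _ (SSet.stdSimplex.objEquiv.symm f) :=
    ConcreteCategory.congr_hom (NatTrans.congr_app sq.w (op k)) ⟨_, hmem f hf⟩
  have ht {k l : SimplexCategory} (e : k ⟶ l) (f : l ⟶ ⦋n⦌) (hf : ¬ Epi f) (hf' : ¬ Epi (e ≫ f)) :
      S.map e.op (t.app _ ⟨_, hmem f hf⟩) = t.app _ ⟨_, hmem (e ≫ f) hf'⟩ :=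
    (NatTrans.naturality_apply t e.op _).symm
  obtain ⟨x, hx, hx'⟩ := H ⦋n⦌ (SSet.yonedaEquiv b)
    (fun f => t.app _ ⟨_, hmem f.obj.hom (hepi f)⟩)
    (fun {f g} θ => by
      have hθ := Over.w θ.hom
      have h1 := ht θ.hom.left g.obj.hom (hepi g) (by rw [hθ]; exact hepi f)
      simp only [hθ] at h1
      exact h1)
    (fun f => by
      refine (hw _ (hepi f)).trans ?_
      refine Eq.trans ?_
        (NatTrans.naturality_apply b f.obj.hom.op (SSet.stdSimplex.objEquiv.symm (𝟙 _)))
      exact congrArg (fun g => b.app _ (SSet.stdSimplex.objEquiv.symm g))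
        (Category.comp_id f.obj.hom).symm)
  have hx'' : SSet.yonedaEquiv.symm x ≫ q = b := by
    apply SSet.yonedaEquiv.injective
    rw [← hx, SSet.yonedaEquiv_comp, Equiv.apply_symm_apply]
  refine ⟨⟨SSet.yonedaEquiv.symm x, ?_, hx''⟩⟩
  ext ⟨k⟩ ⟨s, hs⟩
  obtain ⟨g, rfl⟩ := SSet.stdSimplex.objEquiv.symm.surjective s
  have hg : ¬ Epi g := fun h => hs (SimplexCategory.epi_iff_surjective.1 h)
  -- Every simplex of the boundary is a degeneracy of a proper face, namely its image, so agreement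
  -- on proper faces suffices.
  have hι : ¬ Epi (image.ι g) := fun _ => hg (by rw [← image.fac g]; exact epi_comp _ _)
  have key := hx' (.mk (image.ι g) inferInstance fun _ => hι inferInstance)
  change S.map g.op x = t.app _ ⟨_, hmem g hg⟩
  have h1 := ht (factorThruImage g) (image.ι g) hι (by rwa [image.fac])
  simp only [image.fac] at h1
  rw [← h1]
  refine Eq.trans ?_ (congrArg (S.map (factorThruImage g).op) key)
  have h2 : g.op = (image.ι g).op ≫ (factorThruImage g).op := by rw [← op_comp, image.fac]
  rw [h2]
  exact Functor.map_comp_apply S _ _ _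

/-- A map with the right lifting property with respect to monomorphisms admits homotopies between
maps with the same image. -/
theorem nonempty_homotopy {S S' : SSet.{v}} (q : S ⟶ S')
    (lift : ∀ {K K' : SSet.{v}} (i : K ⟶ K') [Mono i], HasLiftingProperty i q)
    (f : S ⟶ S) (hf : f ≫ q = q) : Nonempty (SSet.Homotopy f (𝟙 S)) := by
  classical
  -- `A` consists of the two ends of the cylinder. They are disjoint, so `f` on one end and the
  -- identity on the other glue to a map, and `f ≫ q = q` makes the lifting square commute.
  let A : (S ⊗ Δ[1] : SSet.{v}).Subcomplex := SSet.Subcomplex.range SSet.ι₀ ⊔ .range SSet.ι₁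
  have disj {m : SimplexCategoryᵒᵖ} (x y : S.obj m) :
      SSet.ι₀.app m x ≠ (SSet.ι₁.app m y : (S ⊗ Δ[1] : SSet.{v}).obj m) := fun h => by
    have h' := congrArg (fun z : (S ⊗ Δ[1] : SSet.{v}).obj m =>
      SSet.stdSimplex.objEquiv z.2 0) h
    exact zero_ne_one (α := Fin 2) h'
  let v (m : SimplexCategoryᵒᵖ) (z : (S ⊗ Δ[1] : SSet.{v}).obj m) : S.obj m :=
    if z ∈ (SSet.Subcomplex.range SSet.ι₀).obj m then f.app m z.1 else z.1
  have v₀ {m : SimplexCategoryᵒᵖ} (x : S.obj m) : v m (SSet.ι₀.app m x) = f.app m x :=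
    if_pos ⟨x, rfl⟩
  have v₁ {m : SimplexCategoryᵒᵖ} (x : S.obj m) : v m (SSet.ι₁.app m x) = x :=
    if_neg fun ⟨y, hy⟩ => disj y x hy
  let a : (A : SSet.{v}) ⟶ S :=
    { app m := TypeCat.ofHom fun z => v m z.1
      naturality m l θ := by
        ext ⟨z, hz⟩
        obtain ⟨x, rfl⟩ | ⟨x, rfl⟩ := hz
        · exact (v₀ (S.map θ x)).trans ((NatTrans.naturality_apply f θ x).trans
            (congrArg (S.map θ) (v₀ x).symm))
        · exact (v₁ (S.map θ x)).trans (congrArg (S.map θ) (v₁ x).symm) }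
  have sq : CommSq a A.ι q (CartesianMonoidalCategory.fst _ _ ≫ q) := ⟨by
    ext m ⟨z, hz⟩
    obtain ⟨x, rfl⟩ | ⟨x, rfl⟩ := hz
    · exact (congrArg (q.app m) (v₀ x)).trans
        (ConcreteCategory.congr_hom (NatTrans.congr_app hf m) x)
    · exact congrArg (q.app m) (v₁ x)⟩
  have := lift A.ι
  have hlift {m : SimplexCategoryᵒᵖ} (z : (A : SSet.{v}).obj m) :
      sq.lift.app m z.1 = a.app m z :=
    ConcreteCategory.congr_hom (NatTrans.congr_app sq.fac_left m) z
  refine ⟨{ h := sq.lift, h₀ := ?_, h₁ := ?_, rel := ?_}⟩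
  · ext m x
    exact (hlift ⟨SSet.ι₀.app m x, Or.inl ⟨x, rfl⟩⟩).trans (v₀ x)
  · ext m x
    exact (hlift ⟨SSet.ι₁.app m x, Or.inr ⟨x, rfl⟩⟩).trans (v₁ x)
  · ext m ⟨⟨_, h⟩, _⟩
    exact h.elim

/-- Trivial Kan fibrations are weak homotopy equivalences. -/
theorem weakHomotopyEquivalences_of_rlp_I {S S' : SSet.{v}} (q : S ⟶ S') (hq : (I.{v}).rlp q) :
    weakHomotopyEquivalences q := by
  rw [← SSet.rlp_monomorphisms] at hq
  have lift {K K' : SSet.{v}} (i : K ⟶ K') [Mono i] : HasLiftingProperty i q :=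
    hq i (MorphismProperty.monomorphisms.infer_property i)
  obtain ⟨s, hs⟩ : ∃ s : S' ⟶ S, s ≫ q = 𝟙 S' := by
    have sq : CommSq (SSet.Subcomplex.isInitialBot.to S) (⊥ : S'.Subcomplex).ι q (𝟙 S') :=
      ⟨SSet.Subcomplex.isInitialBot.hom_ext _ _⟩
    have := lift (⊥ : S'.Subcomplex).ι
    exact ⟨sq.lift, sq.fac_right⟩
  obtain ⟨H⟩ := nonempty_homotopy q lift (q ≫ s) (by rw [Category.assoc, hs, Category.comp_id])
  -- The equation `s ≫ q = 𝟙` makes `q^*` injective; the homotopy from `q ≫ s` to the identity makes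
  -- it surjective.
  intro Z _
  constructor
  · rintro ⟨g⟩ ⟨g'⟩ h
    have h' := congrArg (precompClasses s Z) h
    have key (g : S' ⟶ Z) : precompClasses s Z (precompClasses q Z (Quot.mk _ g)) =
        Quot.mk _ g := by
      change Quot.mk _ (s ≫ q ≫ g) = _
      rw [reassoc_of% hs]
    exact (key g).symm.trans (h'.trans (key g'))
  · rintro ⟨g⟩
    refine ⟨Quot.mk _ (s ≫ g), ?_⟩
    have h : Nonempty (SSet.Homotopy (q ≫ s ≫ g) g) :=
      ⟨SSet.RelativeMorphism.Homotopy.postcomp H (SSet.RelativeMorphism.botEquiv.symm g)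
        (by cat_disch)⟩
    exact Quot.sound h

lemma isoInHo_of_rlp_I {S S' : SSet.{v}} (q : S ⟶ S') (hq : (I.{v}).rlp q) : IsoInHo S S' :=
  ⟨Localization.isoOfHom _ weakHomotopyEquivalences q (weakHomotopyEquivalences_of_rlp_I q hq)⟩

lemma IsoInHo.symm {K K' : SSet.{v}} (h : IsoInHo K K') : IsoInHo K' K :=
  h.map Iso.symm

lemma IsoInHo.trans {K K' K'' : SSet.{v}} (h : IsoInHo K K') (h' : IsoInHo K' K'') :
    IsoInHo K K'' := by
  obtain ⟨e⟩ := h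
  obtain ⟨e'⟩ := h'
  exact ⟨e ≪≫ e'⟩

lemma isoInHo_of_iso {K K' : SSet.{v}} (e : K ≅ K') : IsoInHo K K' :=
  ⟨weakHomotopyEquivalences.Q.mapIso e⟩

end SSetHo

/-! ### Homotopy invariance of mapping spaces -/

namespace CosimplicialFrames

open SSetHo

variable {C : Type u} [Category.{v} C] [ModelCategory C]

/-- Mapping spaces out of a Reedy cofibrant object preserve trivial fibrations. -/
lemma isoInHo_homSSet_of_trivialFibration {A : SimplexCategory ⥤ C} (hA : IsReedyCofibrant A)
    {Z Z' : C} (p : Z ⟶ Z') [hp : Fibration p] [hp' : WeakEquivalence p] :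
    IsoInHo (homSSet A Z) (homSSet A Z') := by
  refine isoInHo_of_rlp_I (Functor.whiskerLeft (Functor.op A) (yoneda.map p))
    (rlp_I_of_latching _ fun N z y hy hyz => ?_)
  exact (isReedyCofibrant_iff A).1 hA p hp hp' N z y hy hyz

/-- Mapping spaces out of a Reedy cofibrant object preserve weak equivalences between fibrant
objects. -/
lemma isoInHo_homSSet_of_weakEquivalence {A : SimplexCategory ⥤ C} (hA : IsReedyCofibrant A)
    {Z Z' : C} (f : Z ⟶ Z') [IsFibrant Z] [IsFibrant Z'] [WeakEquivalence f] :
    IsoInHo (homSSet A Z) (homSSet A Z') := by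
  -- Brown's factorisation replaces `f` by a span of trivial fibrations `h.r` and `h.p` onto `Z` and
  -- `Z'`.
  have h : FibrantBrownFactorization f := Classical.arbitrary _
  have : Fibration h.r := h.fibration_r
  exact (isoInHo_homSSet_of_trivialFibration hA h.r).symm.trans
    (isoInHo_homSSet_of_trivialFibration hA h.p)

/-- Mapping spaces into a fibrant object send Reedy trivial cofibrations to trivial fibrations. -/
lemma isoInHo_homSSet_of_trivialCofibration {A B : SimplexCategory ⥤ C} {φ : A ⟶ B}
    (hφ : IsReedyCofibration φ) (hw : ∀ n, WeakEquivalence (φ.app n)) (Z : C) [IsFibrant Z] :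
    IsoInHo (homSSet B Z) (homSSet A Z) := by
  refine isoInHo_of_rlp_I (Functor.whiskerRight (NatTrans.op φ) (yoneda.obj Z))
    (rlp_I_of_latching _ fun N z y hy hyz => ?_)
  obtain ⟨h, h1, -, h3⟩ := hφ.latchLift_of_fibration hw (terminal.from Z) N z (terminal.from _) y
    (terminalIsTerminal.hom_ext _ _) hy hyz (fun f => terminalIsTerminal.hom_ext _ _)
  exact ⟨h, h1, h3⟩

/-- Mapping spaces do not depend on the resolution of the source. -/
lemma isoInHo_homSSet_of_resolutions {A B : SimplexCategory ⥤ C} (hA : IsReedyCofibrant A)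
    (hB : IsReedyCofibrant B) {W : C} (p : A ⟶ constObj W) (q : B ⟶ constObj W)
    (hp : ∀ n, WeakEquivalence (p.app n)) (hq : ∀ n, WeakEquivalence (q.app n))
    (Z : C) [IsFibrant Z] : IsoInHo (homSSet A Z) (homSSet B Z) := by
  obtain ⟨E, j, r, fac, hj, hr⟩ := exists_reedy_factorization (levelwiseDesc p q)
  have hAj : IsReedyCofibration (levelwiseInl A B ≫ j) :=
    (isReedyCofibration_levelwiseInl A hB).comp hj
  have hBj : IsReedyCofibration (levelwiseInr A B ≫ j) :=
    (isReedyCofibration_levelwiseInr B hA).comp hj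
  have fac' (n : SimplexCategory) : j.app n ≫ r.app n = levelDesc (p.app n) (q.app n) :=
    congrArg (fun t => NatTrans.app t n) fac
  refine (isoInHo_homSSet_of_trivialCofibration hAj (fun n => ?_) Z).symm.trans
    (isoInHo_homSSet_of_trivialCofibration hBj (fun n => ?_) Z)
  · have := hp n
    have := hr n
    refine weakEquivalence_of_postcomp_of_fac (g := r.app n) (fg := p.app n) ?_
    rw [NatTrans.comp_app, Category.assoc, fac', levelwiseInl_levelDesc]
  · have := hq n
    have := hr n
    refine weakEquivalence_of_postcomp_of_fac (g := r.app n) (fg := q.app n) ?_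
    rw [NatTrans.comp_app, Category.assoc, fac', levelwiseInr_levelDesc]

lemma CosimplicialFrame.isReedyCofibrant {X : C} [IsCofibrant X] (F : CosimplicialFrame X) :
    IsReedyCofibrant F.obj :=
  (isReedyCofibrant_ellObj X).of_isReedyCofibration F.isReedyCofibration_i

lemma nonempty_mappingSpaceChoice (X Y : C) : Nonempty (MappingSpaceChoice X Y) := by
  obtain ⟨E, j, p, fac, hj, hp⟩ := exists_reedy_factorization (foldMap X)
  have h := MorphismProperty.factorizationData (trivialCofibrations C) (fibrations C)
    (terminal.from Y)
  have hfib : IsFibrant h.Z := (isFibrant_iff_of_isTerminal h.p terminalIsTerminal).2 inferInstance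
  exact ⟨⟨⟨E, j, p, fac, hj, hp⟩, ⟨h.Z, h.i, inferInstance, inferInstance, hfib⟩⟩⟩

/-- A weak equivalence to a fibrant object extends along fibrant replacements. -/
lemma FibrantReplacement.exists_weakEquivalence {Y Z : C} (F : FibrantReplacement Y) (f : Y ⟶ Z)
    [WeakEquivalence f] [IsFibrant Z] : ∃ g : F.obj ⟶ Z, WeakEquivalence g := by
  have := F.cofibration_ι
  have := F.weakEquivalence_ι
  have sq : CommSq f F.ι (terminal.from Z) (terminal.from F.obj) :=
    ⟨terminalIsTerminal.hom_ext _ _⟩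
  exact ⟨sq.lift, weakEquivalence_of_precomp_of_fac sq.fac_left⟩

/-- Mapping spaces do not depend on the fibrant replacement of the target. -/
lemma isoInHo_homSSet_fibrantReplacement {A : SimplexCategory ⥤ C} (hA : IsReedyCofibrant A)
    {Y Z : C} (F : FibrantReplacement Y) (f : Y ⟶ Z) [WeakEquivalence f] [IsFibrant Z] :
    IsoInHo (homSSet A F.obj) (homSSet A Z) := by
  obtain ⟨g, hg⟩ := F.exists_weakEquivalence f
  have := F.isFibrant_obj
  exact isoInHo_homSSet_of_weakEquivalence hA g

end CosimplicialFrames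

/-! ### Quillen pairs and mapping spaces -/

namespace QuillenPairs

open CosimplicialFrames SSetHo

variable {C : Type u₁} {D : Type u₂} [Category.{v} C] [Category.{v} D]
  [ModelCategory C] [ModelCategory D] {L : C ⥤ D} {R : D ⥤ C} {adj : L ⊣ R}

lemma IsQuillenAdjunction.fibration_map (h : IsQuillenAdjunction adj) {Z Z' : D} (p : Z ⟶ Z')
    [Fibration p] : Fibration (R.map p) := by
  refine fibration_of_hasLiftingProperty _ fun i hi hi' => ?_
  rw [← adj.hasLiftingProperty_iff]
  have := h.cofibration_map i hi
  have := h.weakEquivalence_map i hi hi'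
  infer_instance

lemma IsQuillenAdjunction.trivialFibration_map (h : IsQuillenAdjunction adj) {Z Z' : D}
    (p : Z ⟶ Z') [Fibration p] [WeakEquivalence p] :
    Fibration (R.map p) ∧ WeakEquivalence (R.map p) := by
  refine trivialFibration_of_hasLiftingProperty _ fun i hi => ?_
  rw [← adj.hasLiftingProperty_iff]
  have := h.cofibration_map i hi
  infer_instance

lemma IsQuillenAdjunction.isFibrant_obj (h : IsQuillenAdjunction adj) (Z : D) [IsFibrant Z] :
    IsFibrant (R.obj Z) :=
  have : R.IsRightAdjoint := adj.isRightAdjoint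
  (isFibrant_iff_of_isTerminal (R.map (terminal.from Z))
    (IsTerminal.isTerminalObj R _ terminalIsTerminal)).2 (h.fibration_map _)

lemma IsQuillenAdjunction.isCofibrant_obj (h : IsQuillenAdjunction adj) (X : C) [IsCofibrant X] :
    IsCofibrant (L.obj X) :=
  have : L.IsLeftAdjoint := adj.isLeftAdjoint
  (isCofibrant_iff_of_isInitial (L.map (initial.to X))
    (IsInitial.isInitialObj L _ initialIsInitial)).2 (h.cofibration_map _ inferInstance)

/-- Ken Brown's lemma: `f = b.i ≫ b.p`, where `b.i` and a section `b.s` of `b.p` are trivial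
cofibrations. Two-out-of-three then handles `L.map b.p`. -/
lemma IsQuillenAdjunction.weakEquivalence_map_of_isCofibrant (h : IsQuillenAdjunction adj)
    {X Y : C} (f : X ⟶ Y) [IsCofibrant X] [IsCofibrant Y] [WeakEquivalence f] :
    WeakEquivalence (L.map f) := by
  have b : CofibrantBrownFactorization f := Classical.arbitrary _
  have := h.weakEquivalence_map b.i inferInstance inferInstance
  have := h.weakEquivalence_map b.s b.cofibration_s inferInstance
  have h1 : L.map b.s ≫ L.map b.p = 𝟙 _ := by rw [← L.map_comp, b.s_p, L.map_id]
  have : WeakEquivalence (L.map b.p) := weakEquivalence_of_precomp_of_fac h1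
  rw [← b.fac, L.map_comp]
  infer_instance

lemma IsQuillenAdjunction.isReedyCofibrant (h : IsQuillenAdjunction adj)
    {A : SimplexCategory ⥤ C} (hA : IsReedyCofibrant A) : IsReedyCofibrant (A ⋙ L) := by
  have hA' : IsReedyCofibration (Functor.whiskerRight
      ({ app := fun _ => initial.to _
         naturality := fun _ _ _ => initialIsInitial.hom_ext _ _ } :
        (Functor.const SimplexCategory).obj (⊥_ C) ⟶ A) L) := by
    rw [IsReedyCofibrant, isReedyCofibration_iff] at hA
    rw [isReedyCofibration_iff]
    intro Z Z' p _ _ n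
    obtain ⟨h1, h2⟩ := h.trivialFibration_map p
    exact latchLift_map_of_adjunction adj (hA _ h1 h2 n)
  rw [isReedyCofibration_iff] at hA'
  rw [isReedyCofibrant_iff]
  intro Z Z' p hp hp' n b y hy hyb
  have : L.IsLeftAdjoint := adj.isLeftAdjoint
  -- `L` sends the initial object to an initial object, not necessarily the chosen one.
  have hI : IsInitial (L.obj (⊥_ C)) := IsInitial.isInitialObj L _ initialIsInitial
  obtain ⟨t, -, h2, h3⟩ := hA' p hp hp' n (hI.to _) b y (hI.hom_ext _ _) hy
    (fun f => hI.hom_ext _ _) hyb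
  exact ⟨t, h2, h3⟩

/-- The isomorphism `C(A^•, R Z) ≅ D(L A^•, Z)` of simplicial sets. -/
def homSSetIso (adj : L ⊣ R) (A : SimplexCategory ⥤ C) (Z : D) :
    homSSet A (R.obj Z) ≅ homSSet (A ⋙ L) Z :=
  NatIso.ofComponents (fun n => (adj.homEquiv (A.obj n.unop) Z).symm.toIso) (fun θ => by
    ext g
    exact adj.homEquiv_naturality_left_symm (A.map θ.unop) g)

/-- The adjunction isomorphism for mapping spaces into a fibrant object. -/
lemma IsQuillenAdjunction.isoInHo (h : IsQuillenAdjunction adj) {X : C} [IsCofibrant X]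
    (F : CosimplicialFrame X) (G : CosimplicialFrame (L.obj X)) (Z : D) [IsFibrant Z] :
    IsoInHo (homSSet F.obj (R.obj Z)) (homSSet G.obj Z) := by
  have := h.isCofibrant_obj X
  -- The image of the frame under `L` is used only as a Reedy cofibrant resolution of `L.obj X`, to
  -- be compared with `G`.
  let p : F.obj ⋙ L ⟶ constObj (L.obj X) :=
    { app n := L.map (F.p.app n)
      naturality _ _ θ := by
        refine (L.map_comp _ _).symm.trans ?_
        rw [F.p.naturality, L.map_comp]
        exact congrArg (_ ≫ ·) (L.map_id _) }
  refine (isoInHo_of_iso (homSSetIso adj F.obj Z)).trans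
    (isoInHo_homSSet_of_resolutions (h.isReedyCofibrant F.isReedyCofibrant) G.isReedyCofibrant p G.p
      (fun n => ?_) G.weakEquivalence_p Z)
  have := F.weakEquivalence_p n
  have := F.isReedyCofibrant.isCofibrant n
  have : IsCofibrant ((constObj X).obj n) := inferInstanceAs (IsCofibrant X)
  exact h.weakEquivalence_map_of_isCofibrant (F.p.app n)

end QuillenPairs

end

open CosimplicialFrames QuillenPairs SSetHo in
theorem mainTheorem6 {C : Type u₁} {D : Type u₂} [Category.{v} C] [Category.{v} D]
    [ModelCategory C] [ModelCategory D] {L : C ⥤ D} {R : D ⥤ C} (adj : L ⊣ R) :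
    -- mapping spaces exist in both model categories
    ((∀ A B : C, Nonempty (MappingSpaceChoice A B)) ∧
      (∀ A B : D, Nonempty (MappingSpaceChoice A B))) ∧
    -- the adjunction for mapping spaces, first in derived form, then for fibrant targets
    (IsQuillenAdjunction adj → ∀ (X : C) (Y : D), IsCofibrant X →
      (∀ (F : FibrantReplacement Y) (c : MappingSpaceChoice X (R.obj F.obj))
        (d : MappingSpaceChoice (L.obj X) Y), IsoInHo c.map d.map) ∧
      (IsFibrant Y → ∀ (c : MappingSpaceChoice X (R.obj Y))
        (d : MappingSpaceChoice (L.obj X) Y), IsoInHo c.map d.map)) ∧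
    -- invariance of mapping spaces under Quillen equivalences
    (IsQuillenEquivalence adj → ∀ X X' : C, IsCofibrant X → IsCofibrant X' →
      ∀ (c : MappingSpaceChoice X X') (d : MappingSpaceChoice (L.obj X) (L.obj X')),
        IsoInHo c.map d.map) := by
  have key (h : IsQuillenAdjunction adj) (X : C) (Y : D) (hX : IsCofibrant X)
      (F : FibrantReplacement Y) (c : MappingSpaceChoice X (R.obj F.obj))
      (d : MappingSpaceChoice (L.obj X) Y) : IsoInHo c.map d.map := by
    have := F.isFibrant_obj
    have := F.weakEquivalence_ι
    have := h.isFibrant_obj F.obj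
    have := h.isCofibrant_obj X
    -- `R.obj F.obj` is already fibrant, so its replacement `c.fib` is compared with it along the
    -- identity.
    exact (isoInHo_homSSet_fibrantReplacement c.frame.isReedyCofibrant c.fib (𝟙 _)).trans
      ((h.isoInHo c.frame d.frame F.obj).trans
        (isoInHo_homSSet_fibrantReplacement d.frame.isReedyCofibrant d.fib F.ι).symm)
  refine ⟨⟨nonempty_mappingSpaceChoice, nonempty_mappingSpaceChoice⟩,
    fun h X Y hX => ⟨key h X Y hX, fun hY c d => ?_⟩, fun h X X' hX hX' c d => ?_⟩
  · exact key h X Y hX ⟨Y, 𝟙 Y, inferInstance, inferInstance, hY⟩ c d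
  · have := d.fib.isFibrant_obj
    have := h.isFibrant_obj d.fib.obj
    -- The Quillen equivalence turns the replacement map of `L.obj X'` into a weak equivalence from
    -- `X'` to a fibrant object, so that object can replace the target `c.fib.obj`.
    have := (h.weakEquivalence_iff X' d.fib.obj d.fib.ι hX' inferInstance).1
      d.fib.weakEquivalence_ι
    exact (isoInHo_homSSet_fibrantReplacement c.frame.isReedyCofibrant c.fib
      (adj.homEquiv X' d.fib.obj d.fib.ι)).trans (h.isoInHo c.frame d.frame d.fib.obj)
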